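/- Let $L_1,L_2>0$, $K>0$, $t\ge 0$ and $\Omega=(-L_1,L_1)\times(-L_2,L_2)\times(0,1)$. For $\mathbf n\in W^{1,2}(\Omega,\mathbb S^2)$ (that is, $\mathbf n\in W^{1,2}(\Omega,\mathbb R^3)$ with $|\mathbf n|=1$ almost everywhere) let $$I(\mathbf n)=K\int_\Omega |\nabla\mathbf n|^2+2t\,\mathbf n\cdot\nabla\times\mathbf n+t^2\,dx ,$$ and let $\mathcal A$ be the set of all $\mathbf n\in W^{1,2}(\Omega,\mathbb S^2)$ which, in the sense of traces, satisfy $\mathbf n|_{z=0}=\mathbf e_1$, $\mathbf n|_{z=1}=\mathbf e_3$, $\mathbf n|_{x=-L_1}=\mathbf n|_{x=L_1}$ and $\mathbf n|_{y=-L_2}=\mathbf n|_{y=L_2}$. There is exactly one real constant $D$ for which $D-t^2\cos^2u>0$ on $(0,\pi/2)$, the integral below converges, and $$\int_0^{\pi/2}\frac{du}{(D-t^2\cos^2u)^{1/2}}=1 ;$$ it satisfies $D>t^2$. With this $D$, for every $z\in[0,1]$ there is exactly one real number $\theta(z)$ such that $$\int_0^{\theta(z)}\frac{du}{(D-t^2\cos^2u)^{1/2}}=z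 .$$ With $\phi(z)=tz$, the director field $$\mathbf n^*(x,y,z)=\bigl(\cos\phi(z)\cos\theta(z),\ \sin\phi(z)\cos\theta(z),\ \sin\theta(z)\bigr)$$ belongs to $\mathcal A$ and is the unique global minimiser of $I$ among all $\mathbf n\in\mathcal A$ that depend only on $z$: $I(\mathbf n^*)\le I(\mathbf n)$ for every such $\mathbf n$, with equality only if $\mathbf n=\mathbf n^*$ almost everywhere in $\Omega$. -/

import Mathlib

open MeasureTheory Set Filter Topology
open scoped ContDiff

noncomputable section

namespace Cholesteric

/-- Points of the domain, with Lebesgue measure `volume`; the coordinates `0, 1, 2` are `x, y, z`. -/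
abbrev Pt : Type := Fin 3 → ℝ

/-- Values of vector fields, with the Euclidean norm. -/
abbrev Vec : Type := EuclideanSpace ℝ (Fin 3)

/-- The open box `∏ i, (a i, b i)`. -/
def box {d : ℕ} (a b : Fin d → ℝ) : Set (Fin d → ℝ) :=
  Set.pi univ fun i => Ioo (a i) (b i)

/-- The classical partial derivative `∂ u / ∂ x_i`. -/
def partialDeriv {F : Type*} [NormedAddCommGroup F] [NormedSpace ℝ F] (i : Fin 3) (u : Pt → F)
    (x : Pt) : F :=
  fderiv ℝ u x (Pi.single i 1)

/-- `g` is a weak partial derivative `∂ u / ∂ x_i` on the open set `Ω`. -/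
def IsWeakPartial (Ω : Set Pt) (i : Fin 3) (u g : Pt → Vec) : Prop :=
  ∀ φ : Pt → ℝ, ContDiff ℝ ∞ φ → HasCompactSupport φ → tsupport φ ⊆ Ω →
    ∫ x in Ω, partialDeriv i φ x • u x = - ∫ x in Ω, φ x • g x

/-- `u ∈ W^{1,2}(Ω, ℝ³)`. -/
def MemW12 (Ω : Set Pt) (u : Pt → Vec) : Prop :=
  MemLp u 2 (volume.restrict Ω) ∧
    ∀ i : Fin 3, ∃ g : Pt → Vec, MemLp g 2 (volume.restrict Ω) ∧ IsWeakPartial Ω i u g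

open Classical in
/-- The square integrable weak partial derivative `∂ u / ∂ x_i` on `Ω` (unique up to null sets);
it is `0` by convention if there is none. -/
def weakPartial (Ω : Set Pt) (i : Fin 3) (u : Pt → Vec) : Pt → Vec :=
  if h : ∃ g : Pt → Vec, MemLp g 2 (volume.restrict Ω) ∧ IsWeakPartial Ω i u g
  then h.choose else 0

/-- The trace of `u ∈ W^{1,2}(box a b, ℝ³)` on the face of the box that lies in the plane `x_i = c`
(where `c` is `a i` or `b i`) is `g`, a square integrable function of the two other coordinates:
some sequence of `C¹` functions converges to `u` in `W^{1,2}(box a b)` while its restrictions to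
the face converge to `g` in `L²`. -/
def HasFaceTrace (a b : Fin 3 → ℝ) (u : Pt → Vec) (i : Fin 3) (c : ℝ)
    (g : (Fin 2 → ℝ) → Vec) : Prop :=
  MemLp g 2 (volume.restrict (box (i.removeNth a) (i.removeNth b))) ∧
  ∃ v : ℕ → Pt → Vec, (∀ k, ContDiff ℝ 1 (v k)) ∧
    Tendsto (fun k => eLpNorm (v k - u) 2 (volume.restrict (box a b))) atTop (𝓝 0) ∧
    (∀ j : Fin 3, Tendsto (fun k => eLpNorm (partialDeriv j (v k) - weakPartial (box a b) j u) 2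
      (volume.restrict (box a b))) atTop (𝓝 0)) ∧
    Tendsto (fun k => eLpNorm (fun y : Fin 2 → ℝ => v k (i.insertNth (α := fun _ => ℝ) c y) - g y) 2
      (volume.restrict (box (i.removeNth a) (i.removeNth b)))) atTop (𝓝 0)

/-- The lower corner of the cell. -/
def lo (L₁ L₂ : ℝ) : Fin 3 → ℝ := ![-L₁, -L₂, 0]

/-- The upper corner of the cell. -/
def hi (L₁ L₂ : ℝ) : Fin 3 → ℝ := ![L₁, L₂, 1]

/-- The cuboid `(-L₁, L₁) × (-L₂, L₂) × (0, 1)`. -/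
def cell (L₁ L₂ : ℝ) : Set Pt := box (lo L₁ L₂) (hi L₁ L₂)

/-- `n ∈ W^{1,2}(Ω, 𝕊²)` with `n = e₁` on `z = 0`, `n = e₃` on `z = 1`, and equal traces on
opposite lateral faces. -/
structure Admissible (L₁ L₂ : ℝ) (n : Pt → Vec) : Prop where
  memW12 : MemW12 (cell L₁ L₂) n
  unit : ∀ᵐ x ∂(volume.restrict (cell L₁ L₂)), ‖n x‖ = 1
  bottom : HasFaceTrace (lo L₁ L₂) (hi L₁ L₂) n 2 0 fun _ => !₂[1, 0, 0]
  top : HasFaceTrace (lo L₁ L₂) (hi L₁ L₂) n 2 1 fun _ => !₂[0, 0, 1]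
  periodic_x : ∃ g : (Fin 2 → ℝ) → Vec,
    HasFaceTrace (lo L₁ L₂) (hi L₁ L₂) n 0 (-L₁) g ∧ HasFaceTrace (lo L₁ L₂) (hi L₁ L₂) n 0 L₁ g
  periodic_y : ∃ g : (Fin 2 → ℝ) → Vec,
    HasFaceTrace (lo L₁ L₂) (hi L₁ L₂) n 1 (-L₂) g ∧ HasFaceTrace (lo L₁ L₂) (hi L₁ L₂) n 1 L₂ g

/-- Up to a null set, `n` depends only on `z` in the cell. -/
def DependsOnlyOnZ (L₁ L₂ : ℝ) (n : Pt → Vec) : Prop :=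
  ∃ m : ℝ → Vec, n =ᵐ[volume.restrict (cell L₁ L₂)] fun x => m (x 2)

/-- The curl of a vector field whose partial derivatives are `p i = ∂ n / ∂ x_i`. -/
def curl (p : Fin 3 → Vec) : Vec :=
  !₂[p 1 2 - p 2 1, p 2 0 - p 0 2, p 0 1 - p 1 0]

/-- The one-constant energy `K ∫_Ω |∇n|² + 2 t n · curl n + t² dx`. -/
def energy (K t L₁ L₂ : ℝ) (n : Pt → Vec) : ℝ :=
  K * ∫ x in cell L₁ L₂,
    ((∑ i : Fin 3, ‖weakPartial (cell L₁ L₂) i n x‖ ^ 2)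
      + 2 * t * inner ℝ (n x) (curl fun i => weakPartial (cell L₁ L₂) i n x) + t ^ 2)

/-- The unit vector with Euler angles `θ` (out of the `(x, y)`-plane) and `φ`. -/
def director (θ φ : ℝ) : Vec :=
  !₂[Real.cos φ * Real.cos θ, Real.sin φ * Real.cos θ, Real.sin θ]

/-- The integrand `(D - t² cos² u)^{-1/2}`. -/
def integrand (t D u : ℝ) : ℝ := 1 / √(D - t ^ 2 * Real.cos u ^ 2)

/-- `D` satisfies `∫_0^{π/2} (D - t² cos² u)^{-1/2} du = 1`, where it is required that the radicand
is positive on `(0, π/2)` and that the integral converges. -/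
def IsTwistConstant (t D : ℝ) : Prop :=
  (∀ u ∈ Ioo 0 (Real.pi / 2), 0 < D - t ^ 2 * Real.cos u ^ 2) ∧
  IntervalIntegrable (integrand t D) volume 0 (Real.pi / 2) ∧
  ∫ u in (0 : ℝ)..(Real.pi / 2), integrand t D u = 1

end Cholesteric

end

/-!
For a field `n` that depends only on `z` the derivatives in `x` and `y` vanish, and with
`g = ∂_z n`, `J a = (a₁, -a₀, 0)` the energy density is `|g|² + 2 t (J n · g) + t²`. It is quadratic in
`(n, g)`, so the energy of `n` can be expanded exactly about the candidate
`ν(z) = director (Θ z) (t z)`, where `Θ' = (D - t² cos² Θ)^{1/2}`, `Θ 0 = 0`, `Θ 1 = π / 2`. Put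
`h = n - ν`, `k = ∂_z h`. The Euler–Lagrange equation of `ν` together with `2 ν · h = -|h|²`, which is the
constraint `|n| = |ν| = 1`, turns the first-order term into a second-order one, up to a null
Lagrangian, and the excess of the energy becomes
`K ∫ |k + t J h|² + t² h₂² - Λ |h|²` with `Λ = Θ'² + t² sin² Θ`.

This quadratic form is positive because `-d²/dz² - Λ` is positive on functions vanishing at
`z = 0` and `z = 1`: the equation `-y'' = Λ y` is solved by `cos Θ`, which has no zero in `[0, 1)`, and
perturbing this solution gives a strict supersolution that is positive on `[0, 1]`
(`IsAngleProfile.exists_supersolution`). With `w = -y' / y`, adding the null Lagrangian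
`∂_z (w |h|²)` completes the square, and there remains `∫ (w' - w² - Λ) |h|² ≥ μ ∫ |h|²` with `μ > 0`
(`IsAngleProfile.exists_riccati`, `density_sub_density_ge`). Hence the energy of `n` exceeds that
of `ν` by at least `K μ ∫ |n - ν|²` (`IsAngleProfile.exists_energy_gap`), which yields both
minimality and uniqueness.

The null Lagrangians integrate to zero since `h` has zero trace on the bottom and the top of the
cell. This is shown on the cell itself, with the divergence theorem for the `C¹` functions that
define the traces (`integral_inner_add_inner_eq_zero`), so no representative of `n` on the interval
`(0, 1)` is needed.

The constant `D` exists and is unique because `∫₀^{π/2} (D - t² cos² u)^{-1/2} du` is continuous and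
strictly decreasing in `D > t²`, at least `1` for `D` close to `t²`, and at most `1` for
`D = t² + π² / 4`.
-/

namespace Cholesteric

/-! ### The twist constant -/

lemma radicand_pos {t D : ℝ} (hD : t ^ 2 < D) (u : ℝ) : 0 < D - t ^ 2 * Real.cos u ^ 2 := by
  nlinarith [Real.cos_sq_le_one u, sq_nonneg t]

lemma continuous_integrand {t D : ℝ} (hD : t ^ 2 < D) : Continuous (integrand t D) := by
  unfold integrand
  exact continuous_const.div (by fun_prop) fun u => (Real.sqrt_pos.2 (radicand_pos hD u)).ne'

lemma integrand_pos {t D : ℝ} (hD : t ^ 2 < D) (u : ℝ) : 0 < integrand t D u :=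
  one_div_pos.2 (Real.sqrt_pos.2 (radicand_pos hD u))

/-- The borderline value `D = t²` is excluded because there the integrand is `1 / (t sin u)`,
which is not integrable at `0`. -/
lemma IsTwistConstant.lt {t D : ℝ} (ht : 0 ≤ t) (h : IsTwistConstant t D) : t ^ 2 < D := by
  obtain ⟨hpos, hint, -⟩ := h
  have hpi : (0 : ℝ) < Real.pi / 2 := by positivity
  have hle : t ^ 2 ≤ D := by
    have hlim : Tendsto (fun u : ℝ => D - t ^ 2 * Real.cos u ^ 2) (𝓝[>] 0)
        (𝓝 (D - t ^ 2 * Real.cos 0 ^ 2)) :=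
      ((by fun_prop : Continuous fun u : ℝ => D - t ^ 2 * Real.cos u ^ 2).tendsto 0).mono_left
        nhdsWithin_le_nhds
    have := ge_of_tendsto hlim (b := 0) (by
      filter_upwards [Ioo_mem_nhdsGT hpi] with u hu using (hpos u hu).le)
    simp only [Real.cos_zero] at this
    linarith
  refine lt_of_le_of_ne hle fun hD => ?_
  subst hD
  rcases ht.eq_or_lt with rfl | ht'
  · simpa using hpos (Real.pi / 4) ⟨by positivity, by linarith [Real.pi_pos]⟩
  have hinv : IntervalIntegrable (fun u : ℝ => u⁻¹) volume 0 (Real.pi / 2) := by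
    refine (hint.const_mul t).mono_fun' (by fun_prop) ?_
    rw [uIoc_of_le hpi.le]
    filter_upwards [ae_restrict_mem measurableSet_Ioc] with u hu
    have hs : 0 < Real.sin u := Real.sin_pos_of_pos_of_lt_pi hu.1 (by linarith [hu.2])
    have hrad : t ^ 2 - t ^ 2 * Real.cos u ^ 2 = (t * Real.sin u) ^ 2 := by
      rw [mul_pow, Real.sin_sq]; ring
    rw [integrand, hrad, Real.sqrt_sq (by positivity), Real.norm_of_nonneg (inv_nonneg.2 hu.1.le)]
    have : t * (1 / (t * Real.sin u)) = (Real.sin u)⁻¹ := by field_simp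
    rw [this]
    exact inv_anti₀ hs (Real.sin_le hu.1.le)
  rw [intervalIntegrable_inv_iff] at hinv
  rcases hinv with h0 | h0
  · exact hpi.ne h0
  · exact h0 left_mem_uIcc

lemma integral_integrand_strictAnti {t D D' : ℝ} (hD : t ^ 2 < D) (hDD' : D < D') :
    ∫ u in (0 : ℝ)..(Real.pi / 2), integrand t D' u <
      ∫ u in (0 : ℝ)..(Real.pi / 2), integrand t D u := by
  have hlt : ∀ u, integrand t D' u < integrand t D u := fun u =>
    one_div_lt_one_div_of_lt (Real.sqrt_pos.2 (radicand_pos hD u))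
      (Real.sqrt_lt_sqrt (radicand_pos hD u).le (by linarith))
  exact intervalIntegral.integral_lt_integral_of_continuousOn_of_le_of_exists_lt (by positivity)
    (continuous_integrand (hD.trans hDD')).continuousOn (continuous_integrand hD).continuousOn
    (fun u _ => (hlt u).le) ⟨0, left_mem_Icc.2 (by positivity), hlt 0⟩

/-- With `D = t² + δ²` the integrand is at least `1 / (δ + t u)`, because `sin u ≤ u`. -/
lemma one_le_integral_integrand {t : ℝ} (ht : 0 ≤ t) :
    1 ≤ ∫ u in (0 : ℝ)..(Real.pi / 2),
      integrand t (t ^ 2 + (Real.pi / 2 * Real.exp (-t)) ^ 2) u := by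
  set δ := Real.pi / 2 * Real.exp (-t) with hδ
  have hpi : (0 : ℝ) < Real.pi / 2 := by positivity
  have hδ0 : 0 < δ := by positivity
  have hD : t ^ 2 < t ^ 2 + δ ^ 2 := by nlinarith
  have hpos : ∀ u ∈ Icc 0 (Real.pi / 2), 0 < δ + t * u := fun u hu => by
    have := mul_nonneg ht hu.1
    linarith
  have hcont : ContinuousOn (fun u : ℝ => 1 / (δ + t * u)) (Icc 0 (Real.pi / 2)) :=
    continuousOn_const.div (by fun_prop) fun u hu => (hpos u hu).ne'
  have hii : IntervalIntegrable (fun u : ℝ => 1 / (δ + t * u)) volume 0 (Real.pi / 2) :=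
    ContinuousOn.intervalIntegrable (by rwa [uIcc_of_le hpi.le])
  refine le_trans ?_ (intervalIntegral.integral_mono_on hpi.le hii
    ((continuous_integrand hD).intervalIntegrable _ _) fun u hu => ?_)
  · rcases ht.eq_or_lt with rfl | ht'
    · have : δ = Real.pi / 2 := by simp [hδ]
      simp [this]
    · have hint : ∫ u in (0 : ℝ)..(Real.pi / 2), 1 / (δ + t * u) =
          Real.log (δ + t * (Real.pi / 2)) / t - Real.log (δ + t * 0) / t := by
        refine intervalIntegral.integral_eq_sub_of_hasDerivAt (f := fun u => Real.log (δ + t * u) / t)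
          (fun u hu => ?_) hii
        rw [uIcc_of_le hpi.le] at hu
        have h1 : HasDerivAt (fun u : ℝ => δ + t * u) t u := by
          simpa using ((hasDerivAt_id u).const_mul t).const_add δ
        refine ((h1.log (hpos u hu).ne').div_const t).congr_deriv ?_
        have := (hpos u hu).ne'
        field_simp
      rw [hint, ← sub_div, le_div_iff₀ ht', one_mul, mul_zero, add_zero,
        ← Real.log_div (by positivity) hδ0.ne', Real.le_log_iff_exp_le (by positivity),
        le_div_iff₀ hδ0]
      have : Real.exp t * δ = Real.pi / 2 := by
        rw [hδ, mul_left_comm, ← Real.exp_add]; simp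
      -- `exp t ≤ 1 + t exp t` is `1 - t ≤ exp (-t)` multiplied by `exp t`
      have h1 := Real.add_one_le_exp (-t)
      nlinarith
  · refine one_div_le_one_div_of_le (Real.sqrt_pos.2 (radicand_pos hD u)) ?_
    rw [Real.sqrt_le_left (hpos u hu).le]
    have h1 : Real.sin u ^ 2 ≤ u ^ 2 :=
      pow_le_pow_left₀ (Real.sin_nonneg_of_nonneg_of_le_pi hu.1 (by linarith [hu.2]))
        (Real.sin_le hu.1) 2
    have h2 : Real.cos u ^ 2 = 1 - Real.sin u ^ 2 := Real.cos_sq' u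
    nlinarith [mul_nonneg (mul_nonneg hδ0.le ht) hu.1, mul_le_mul_of_nonneg_left h1 (sq_nonneg t)]

lemma integral_integrand_le_one (t : ℝ) :
    ∫ u in (0 : ℝ)..(Real.pi / 2), integrand t (t ^ 2 + (Real.pi / 2) ^ 2) u ≤ 1 := by
  have hpi : (0 : ℝ) < Real.pi / 2 := by positivity
  have hD : t ^ 2 < t ^ 2 + (Real.pi / 2) ^ 2 := by nlinarith
  calc ∫ u in (0 : ℝ)..(Real.pi / 2), integrand t (t ^ 2 + (Real.pi / 2) ^ 2) u
      ≤ ∫ _u in (0 : ℝ)..(Real.pi / 2), 1 / (Real.pi / 2) := by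
        refine intervalIntegral.integral_mono_on hpi.le
          ((continuous_integrand hD).intervalIntegrable _ _)
          (continuous_const.intervalIntegrable _ _) fun u _ => ?_
        refine one_div_le_one_div_of_le hpi (Real.le_sqrt_of_sq_le ?_)
        nlinarith [Real.cos_sq_le_one u, sq_nonneg t]
    _ = 1 := by
        rw [intervalIntegral.integral_const, smul_eq_mul]
        field_simp
        norm_num

theorem existsUnique_isTwistConstant {t : ℝ} (ht : 0 ≤ t) : ∃! D : ℝ, IsTwistConstant t D := by
  have hpi : (0 : ℝ) < Real.pi / 2 := by positivity
  have hcont : ContinuousOn (fun D => ∫ u in (0 : ℝ)..(Real.pi / 2), integrand t D u)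
      (Ioi (t ^ 2)) := by
    rw [continuousOn_iff_continuous_domRestrict]
    refine intervalIntegral.continuous_parametric_intervalIntegral_of_continuous'
      (f := fun (D : Ioi (t ^ 2)) u => integrand t D u) ?_ _ _
    refine continuous_const.div (by fun_prop) fun p => ?_
    exact (Real.sqrt_pos.2 (radicand_pos p.1.2 p.2)).ne'
  have hmem := isPreconnected_Ioi.intermediate_value
    (mem_Ioi.2 (lt_add_of_pos_right (t ^ 2) (by positivity : 0 < (Real.pi / 2) ^ 2)))
    (mem_Ioi.2 (lt_add_of_pos_right (t ^ 2)
      (by positivity : 0 < (Real.pi / 2 * Real.exp (-t)) ^ 2))) hcont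
    ⟨integral_integrand_le_one t, one_le_integral_integrand ht⟩
  obtain ⟨D, hD, hD1⟩ := hmem
  refine ⟨D, ⟨fun u _ => radicand_pos hD u, (continuous_integrand hD).intervalIntegrable _ _, hD1⟩,
    fun D' h' => ?_⟩
  have hD' := h'.lt ht
  rcases lt_trichotomy D' D with hlt | heq | hlt
  · have := integral_integrand_strictAnti hD' hlt
    rw [h'.2.2] at this
    exact absurd hD1 this.ne
  · exact heq
  · have := integral_integrand_strictAnti hD hlt
    rw [h'.2.2] at this
    exact absurd hD1 this.ne'

/-! ### Weak derivatives -/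

lemma isOpen_box {d : ℕ} (a b : Fin d → ℝ) : IsOpen (box a b) :=
  isOpen_set_pi finite_univ fun _ _ => isOpen_Ioo

lemma box_ae_eq_Icc {d : ℕ} (a b : Fin d → ℝ) : box a b =ᵐ[volume] Icc a b :=
  Measure.univ_pi_Ioo_ae_eq_Icc

lemma box_subset_Icc {d : ℕ} (a b : Fin d → ℝ) : box a b ⊆ Icc a b := fun _ hx =>
  ⟨fun i => (hx i trivial).1.le, fun i => (hx i trivial).2.le⟩

instance isFiniteMeasure_restrict_box {d : ℕ} (a b : Fin d → ℝ) :
    IsFiniteMeasure (volume.restrict (box a b)) :=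
  ⟨by
    rw [Measure.restrict_apply_univ, measure_congr (box_ae_eq_Icc a b)]
    exact isCompact_Icc.measure_lt_top⟩

/-- A continuous function on the closed box belongs to every `Lᵖ` of the open box. -/
lemma memLp_of_continuousOn_Icc {F : Type*} [NormedAddCommGroup F] {d : ℕ}
    {a b : Fin d → ℝ} {u : (Fin d → ℝ) → F} (hu : ContinuousOn u (Icc a b)) (p : ENNReal) :
    MemLp u p (volume.restrict (box a b)) := by
  obtain ⟨C, hC⟩ := isCompact_Icc.exists_bound_of_continuousOn hu
  rw [Measure.restrict_congr_set (box_ae_eq_Icc a b)]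
  have : IsFiniteMeasure (volume.restrict (Icc a b)) :=
    ⟨by rw [Measure.restrict_apply_univ]; exact isCompact_Icc.measure_lt_top⟩
  refine MemLp.of_bound (hu.aestronglyMeasurable_of_isCompact isCompact_Icc measurableSet_Icc) C ?_
  filter_upwards [ae_restrict_mem measurableSet_Icc] with x hx using hC x hx

lemma continuous_partialDeriv {F : Type*} [NormedAddCommGroup F] [NormedSpace ℝ F] {i : Fin 3}
    {u : Pt → F} (hu : ContDiff ℝ 1 u) : Continuous (partialDeriv i u) :=
  (hu.continuous_fderiv one_ne_zero).clm_apply continuous_const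

lemma hasCompactSupport_partialDeriv {i : Fin 3} {φ : Pt → ℝ} (h : HasCompactSupport φ) :
    HasCompactSupport (partialDeriv i φ) :=
  h.fderiv_apply ℝ _

lemma partialDeriv_eq_zero_of_notMem {i : Fin 3} {φ : Pt → ℝ} {x : Pt} (h : x ∉ tsupport φ) :
    partialDeriv i φ x = 0 := by
  rw [partialDeriv, fderiv_of_notMem_tsupport ℝ h]
  rfl

theorem IsWeakPartial.ae_unique {Ω : Set Pt} (hΩ : IsOpen Ω) {i : Fin 3} {u g g' : Pt → Vec}
    (hg : IsWeakPartial Ω i u g) (hg' : IsWeakPartial Ω i u g')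
    (hgi : MemLp g 2 (volume.restrict Ω)) (hgi' : MemLp g' 2 (volume.restrict Ω)) :
    g =ᵐ[volume.restrict Ω] g' := by
  have hloc : ∀ {f : Pt → Vec}, MemLp f 2 (volume.restrict Ω) →
      LocallyIntegrable f (volume.restrict Ω) := fun hf => hf.locallyIntegrable (by norm_num)
  have hsub : LocallyIntegrable (g - g') (volume.restrict Ω) := (hloc hgi).sub (hloc hgi')
  have key : ∀ᵐ x ∂(volume.restrict Ω), x ∈ Ω → (g - g') x = 0 := by
    refine hΩ.ae_eq_zero_of_integral_contDiff_smul_eq_zero (hsub.locallyIntegrableOn Ω) ?_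
    intro φ hφ hc hs
    have h1 := hg φ hφ hc hs
    rw [hg' φ hφ hc hs, neg_inj] at h1
    simp only [Pi.sub_apply, smul_sub]
    rw [integral_sub, h1, sub_self]
    · exact (hloc hgi).integrable_smul_left_of_hasCompactSupport hφ.continuous hc
    · exact (hloc hgi').integrable_smul_left_of_hasCompactSupport hφ.continuous hc
  filter_upwards [key, ae_restrict_mem hΩ.measurableSet] with x hx hxΩ
  exact sub_eq_zero.1 (hx hxΩ)

theorem isWeakPartial_partialDeriv {Ω : Set Pt} {i : Fin 3} {u : Pt → Vec} (hu : ContDiff ℝ 1 u) :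
    IsWeakPartial Ω i u (partialDeriv i u) := by
  intro φ hφ hc hs
  have hφ1 : ContDiff ℝ 1 φ := hφ.of_le (by exact_mod_cast le_top)
  have hz : ∀ x, x ∉ Ω → φ x = 0 := fun x hx => image_eq_zero_of_notMem_tsupport fun h => hx (hs h)
  rw [setIntegral_eq_integral_of_forall_compl_eq_zero (fun x hx => by
      rw [partialDeriv_eq_zero_of_notMem fun h => hx (hs h), zero_smul]),
    setIntegral_eq_integral_of_forall_compl_eq_zero (fun x hx => by rw [hz x hx, zero_smul])]
  have hi : ∀ {ψ : Pt → ℝ} {v : Pt → Vec}, Continuous ψ → HasCompactSupport ψ → Continuous v →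
      Integrable (fun x => ψ x • v x) := fun hψ hcψ hv =>
    (hψ.smul hv).integrable_of_hasCompactSupport hcψ.smul_right
  have := integral_smul_fderiv_eq_neg_fderiv_smul_of_integrable (μ := volume) (f := φ) (g := u)
    (v := Pi.single i 1)
    (hi (continuous_partialDeriv hφ1) (hasCompactSupport_partialDeriv hc) hu.continuous)
    (hi hφ.continuous hc (continuous_partialDeriv hu)) (hi hφ.continuous hc hu.continuous)
    (fun x _ => hφ1.differentiable one_ne_zero x) (fun x _ => hu.differentiable one_ne_zero x)
  exact (neg_eq_iff_eq_neg.2 this).symm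

lemma IsWeakPartial.congr {Ω : Set Pt} {i : Fin 3} {u u' g : Pt → Vec}
    (h : IsWeakPartial Ω i u g) (huu' : u =ᵐ[volume.restrict Ω] u') : IsWeakPartial Ω i u' g := by
  intro φ hφ hc hs
  rw [← h φ hφ hc hs]
  refine integral_congr_ae ?_
  filter_upwards [huu'] with x hx
  rw [hx]

/-- A function that does not depend on the coordinate `x i` has weak derivative `0` in that
direction. No measurability of `m` is needed: if the integrand is not integrable over the whole
space, its integral is `0` by convention, and otherwise Fubini's theorem applies. -/
theorem isWeakPartial_zero_of_comp {Ω : Set Pt} {i j : Fin 3} (hij : i ≠ j) (m : ℝ → Vec) :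
    IsWeakPartial Ω i (fun x => m (x j)) 0 := by
  intro φ hφ hc hs
  have hφ1 : ContDiff ℝ 1 φ := hφ.of_le (by exact_mod_cast le_top)
  simp only [Pi.zero_apply, smul_zero, integral_zero, neg_zero]
  rw [setIntegral_eq_integral_of_forall_compl_eq_zero (fun x hx => by
      rw [partialDeriv_eq_zero_of_notMem fun h => hx (hs h), zero_smul])]
  by_cases hint : Integrable (fun x : Pt => partialDeriv i φ x • m (x j))
  swap
  · exact integral_undef hint
  obtain ⟨l, rfl⟩ := Fin.exists_succAbove_eq hij.symm
  have hmp := (volume_preserving_piFinSuccAbove (fun _ : Fin 3 => ℝ) i).symm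
  rw [← hmp.integral_comp' (g := fun x : Pt => partialDeriv i φ x • m (x (i.succAbove l)))]
  have hint' := (hmp.integrable_comp_emb (MeasurableEquiv.measurableEmbedding _)).2 hint
  rw [Measure.volume_eq_prod] at hint' ⊢
  refine (integral_prod_symm _ hint').trans ?_
  refine integral_eq_zero_of_ae (Eventually.of_forall fun y => ?_)
  have hline : ∀ s : ℝ, HasDerivAt (fun s => i.insertNth (α := fun _ => ℝ) s y)
      (Pi.single i 1 : Pt) s := by
    intro s
    rw [hasDerivAt_pi]
    intro k
    rcases Fin.eq_self_or_eq_succAbove i k with rfl | ⟨k, rfl⟩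
    · simpa using hasDerivAt_id' s
    · simpa using hasDerivAt_const s (y k)
  have hcont : Continuous (fun s => i.insertNth (α := fun _ => ℝ) s y : ℝ → Pt) :=
    continuous_iff_continuousAt.2 fun s => (hline s).continuousAt
  have hcs : ∀ {ψ : Pt → ℝ}, HasCompactSupport ψ → Continuous ψ →
      Integrable fun s => ψ (i.insertNth (α := fun _ => ℝ) s y) := by
    intro ψ hψ hψc
    refine (hψc.comp hcont).integrable_of_hasCompactSupport ?_
    refine HasCompactSupport.intro (hψ.isCompact.image (continuous_apply i)) fun s hs => ?_
    refine image_eq_zero_of_notMem_tsupport (f := ψ) fun hmem => hs ⟨_, hmem, ?_⟩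
    simp
  have hder : ∀ s : ℝ, HasDerivAt (fun s => φ (i.insertNth (α := fun _ => ℝ) s y))
      (partialDeriv i φ (i.insertNth (α := fun _ => ℝ) s y)) s := fun s =>
    ((hφ1.differentiable one_ne_zero _).hasFDerivAt).comp_hasDerivAt s (hline s)
  have hzero := integral_eq_zero_of_hasDerivAt_of_integrable hder
    (hcs (hasCompactSupport_partialDeriv hc) (continuous_partialDeriv hφ1))
    (hcs hc hφ.continuous)
  simp only [Function.comp_apply, MeasurableEquiv.piFinSuccAbove_symm_apply,
    Fin.insertNthEquiv_apply, Fin.insertNth_apply_succAbove, integral_smul_const, Pi.zero_apply]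
  exact smul_eq_zero_of_left hzero _

lemma MemW12.weakPartial_spec {Ω : Set Pt} {u : Pt → Vec} (h : MemW12 Ω u) (i : Fin 3) :
    MemLp (weakPartial Ω i u) 2 (volume.restrict Ω) ∧ IsWeakPartial Ω i u (weakPartial Ω i u) := by
  rw [weakPartial, dif_pos (h.2 i)]
  exact (h.2 i).choose_spec

/-- The weak derivatives of a field that depends on `z` alone vanish in the directions `x`, `y`. -/
lemma DependsOnlyOnZ.weakPartial_eq_zero {L₁ L₂ : ℝ} {n : Pt → Vec} (h : DependsOnlyOnZ L₁ L₂ n)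
    (hn : MemW12 (cell L₁ L₂) n) {i : Fin 3} (hi : i ≠ 2) :
    weakPartial (cell L₁ L₂) i n =ᵐ[volume.restrict (cell L₁ L₂)] 0 := by
  obtain ⟨m, hm⟩ := h
  exact (hn.weakPartial_spec i).2.ae_unique (isOpen_box _ _)
    ((isWeakPartial_zero_of_comp hi m).congr hm.symm) (hn.weakPartial_spec i).1 MemLp.zero

lemma memW12_of_contDiff {a b : Fin 3 → ℝ} {u : Pt → Vec} (hu : ContDiff ℝ 1 u) :
    MemW12 (box a b) u :=
  ⟨memLp_of_continuousOn_Icc hu.continuous.continuousOn 2, fun i => ⟨partialDeriv i u,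
    memLp_of_continuousOn_Icc (continuous_partialDeriv hu).continuousOn 2,
    isWeakPartial_partialDeriv hu⟩⟩

lemma MemW12.congr {Ω : Set Pt} {u u' : Pt → Vec} (h : MemW12 Ω u)
    (huu' : u =ᵐ[volume.restrict Ω] u') : MemW12 Ω u' :=
  ⟨(memLp_congr_ae huu').1 h.1, fun i =>
    let ⟨g, hg, hw⟩ := h.2 i
    ⟨g, hg, hw.congr huu'⟩⟩

lemma weakPartial_ae_eq_partialDeriv {a b : Fin 3 → ℝ} {u N : Pt → Vec} (hN : ContDiff ℝ 1 N)
    (hu : N =ᵐ[volume.restrict (box a b)] u) (i : Fin 3) :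
    weakPartial (box a b) i u =ᵐ[volume.restrict (box a b)] partialDeriv i N := by
  have hW := (memW12_of_contDiff (a := a) (b := b) hN).congr hu
  exact (hW.weakPartial_spec i).2.ae_unique (isOpen_box _ _)
    ((isWeakPartial_partialDeriv hN).congr hu) (hW.weakPartial_spec i).1
    (memLp_of_continuousOn_Icc (continuous_partialDeriv hN).continuousOn 2)

/-- A field that agrees almost everywhere on the box with a `C¹` function has the restrictions of
that function as its traces. -/
lemma hasFaceTrace_of_contDiff {a b : Fin 3 → ℝ} {u N : Pt → Vec} (hN : ContDiff ℝ 1 N)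
    (hu : N =ᵐ[volume.restrict (box a b)] u) {i : Fin 3} {c : ℝ} {g : (Fin 2 → ℝ) → Vec}
    (hg : ∀ y, N (i.insertNth (α := fun _ => ℝ) c y) = g y) (hgc : Continuous g) :
    HasFaceTrace a b u i c g := by
  have hz : ∀ {f f' : Pt → Vec}, f =ᵐ[volume.restrict (box a b)] f' →
      eLpNorm (f - f') 2 (volume.restrict (box a b)) = 0 := fun h => by
    rw [eLpNorm_congr_ae (g := 0) (by filter_upwards [h] with x hx; simp [hx]), eLpNorm_zero]
  refine ⟨memLp_of_continuousOn_Icc hgc.continuousOn 2, fun _ => N, fun _ => hN, ?_, fun j => ?_, ?_⟩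
  · simp only [hz hu, tendsto_const_nhds]
  · simp only [hz (weakPartial_ae_eq_partialDeriv hN hu j).symm, tendsto_const_nhds]
  · simp [hg]

/-! ### The angle profile -/

lemma hasDerivAt_integral_integrand {t D : ℝ} (hD : t ^ 2 < D) (s : ℝ) :
    HasDerivAt (fun s => ∫ u in (0 : ℝ)..s, integrand t D u) (integrand t D s) s :=
  ((continuous_integrand hD).integral_hasStrictDerivAt 0 s).hasDerivAt

lemma strictMono_integral_integrand {t D : ℝ} (hD : t ^ 2 < D) :
    StrictMono fun s => ∫ u in (0 : ℝ)..s, integrand t D u :=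
  strictMono_of_deriv_pos fun s => by
    rw [(hasDerivAt_integral_integrand hD s).deriv]
    exact integrand_pos hD s

lemma surjective_integral_integrand {t D : ℝ} (hD : t ^ 2 < D) :
    Function.Surjective fun s => ∫ u in (0 : ℝ)..s, integrand t D u := by
  have hD0 : 0 < D := (sq_nonneg t).trans_lt hD
  have hc : 0 < 1 / √D := by positivity
  have hmono : Monotone fun s : ℝ => (∫ u in (0 : ℝ)..s, integrand t D u) - 1 / √D * s := by
    have hd : ∀ s : ℝ, HasDerivAt
        (fun s : ℝ => (∫ u in (0 : ℝ)..s, integrand t D u) - 1 / √D * s)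
        (integrand t D s - 1 / √D * 1) s := fun s =>
      (hasDerivAt_integral_integrand hD s).sub ((hasDerivAt_id s).const_mul _)
    refine monotone_of_deriv_nonneg (fun s => (hd s).differentiableAt) fun s => ?_
    rw [(hd s).deriv, mul_one, sub_nonneg]
    refine one_div_le_one_div_of_le (Real.sqrt_pos.2 (radicand_pos hD s)) (Real.sqrt_le_sqrt ?_)
    have : 0 ≤ t ^ 2 * Real.cos s ^ 2 := by positivity
    linarith
  refine Continuous.surjective
    (continuous_iff_continuousAt.2 fun s => (hasDerivAt_integral_integrand hD s).continuousAt) ?_ ?_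
  · refine tendsto_atTop_mono' _ ?_ (tendsto_id.const_mul_atTop hc)
    filter_upwards [eventually_ge_atTop 0] with s hs
    simpa using hmono hs
  · refine tendsto_atBot_mono' _ ?_ (tendsto_id.const_mul_atBot hc)
    filter_upwards [eventually_le_atBot 0] with s hs
    simpa using hmono hs

/-- The speed `θ' = (D - t² cos² θ)^{1/2}` at which the angle profile moves. -/
noncomputable def speed (t D θ : ℝ) : ℝ := √(D - t ^ 2 * Real.cos θ ^ 2)

lemma speed_pos {t D : ℝ} (hD : t ^ 2 < D) (θ : ℝ) : 0 < speed t D θ :=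
  Real.sqrt_pos.2 (radicand_pos hD θ)

lemma continuous_speed (t D : ℝ) : Continuous (speed t D) := by
  unfold speed
  fun_prop

/-- `Θ` solves `Θ' = (D - t² cos² Θ)^{1/2}` on the whole line, with `Θ 0 = 0` and `Θ 1 = π / 2`. -/
structure IsAngleProfile (t D : ℝ) (Θ : ℝ → ℝ) : Prop where
  hasDerivAt : ∀ z, HasDerivAt Θ (speed t D (Θ z)) z
  map_zero : Θ 0 = 0
  map_one : Θ 1 = Real.pi / 2

/-- The profile is the inverse function of `s ↦ ∫₀ˢ (D - t² cos² u)^{-1/2} du`. -/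
theorem exists_isAngleProfile {t D : ℝ} (hD : t ^ 2 < D)
    (h1 : ∫ u in (0 : ℝ)..(Real.pi / 2), integrand t D u = 1) :
    ∃ Θ : ℝ → ℝ, IsAngleProfile t D Θ ∧
      ∀ s z : ℝ, (∫ u in (0 : ℝ)..s, integrand t D u) = z ↔ s = Θ z := by
  let e := (strictMono_integral_integrand hD).orderIsoOfSurjective _
    (surjective_integral_integrand hD)
  have he : ∀ s, e s = ∫ u in (0 : ℝ)..s, integrand t D u := fun s => rfl
  have hiff : ∀ s z : ℝ, (∫ u in (0 : ℝ)..s, integrand t D u) = z ↔ s = e.symm z := fun s z => by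
    rw [← he, OrderIso.eq_symm_apply]
  refine ⟨e.symm, ⟨fun z => ?_, ?_, ?_⟩, hiff⟩
  · have := HasDerivAt.of_local_left_inverse (g := e.symm) (a := z) e.symm.continuous.continuousAt
      (hasDerivAt_integral_integrand hD (e.symm z)) (integrand_pos hD _).ne'
      (Eventually.of_forall fun y => e.apply_symm_apply y)
    simpa [integrand, speed] using this
  · exact ((hiff 0 0).1 (by simp)).symm
  · exact ((hiff _ 1).1 h1).symm

namespace IsAngleProfile

variable {t D : ℝ} {Θ : ℝ → ℝ}

lemma continuous (h : IsAngleProfile t D Θ) : Continuous Θ :=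
  continuous_iff_continuousAt.2 fun z => (h.hasDerivAt z).continuousAt

lemma hasDerivAt_cos (h : IsAngleProfile t D Θ) (z : ℝ) :
    HasDerivAt (fun z => Real.cos (Θ z)) (-Real.sin (Θ z) * speed t D (Θ z)) z :=
  (h.hasDerivAt z).cos

lemma hasDerivAt_sin (h : IsAngleProfile t D Θ) (z : ℝ) :
    HasDerivAt (fun z => Real.sin (Θ z)) (Real.cos (Θ z) * speed t D (Θ z)) z :=
  (h.hasDerivAt z).sin

lemma hasDerivAt_speed (h : IsAngleProfile t D Θ) (hD : t ^ 2 < D) (z : ℝ) :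
    HasDerivAt (fun z => speed t D (Θ z)) (t ^ 2 * Real.cos (Θ z) * Real.sin (Θ z)) z := by
  have h1 := (((h.hasDerivAt_cos z).pow 2).const_mul (t ^ 2)).const_sub D
  refine (h1.sqrt (radicand_pos hD (Θ z)).ne').congr_deriv ?_
  have h2 := (speed_pos hD (Θ z)).ne'
  change _ / (2 * speed t D (Θ z)) = _
  field_simp
  norm_num
  ring

lemma mem_Icc (h : IsAngleProfile t D Θ) (hD : t ^ 2 < D) {z : ℝ} (hz : z ∈ Icc (0 : ℝ) 1) :
    Θ z ∈ Icc 0 (Real.pi / 2) := by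
  have hm : StrictMono Θ := strictMono_of_deriv_pos fun s => by
    rw [(h.hasDerivAt s).deriv]
    exact speed_pos hD _
  rw [← h.map_zero, ← h.map_one]
  exact ⟨hm.monotone hz.1, hm.monotone hz.2⟩

/-- A strict supersolution of `-y'' = (Θ'² + t² sin² Θ) y`. The equation itself is solved by
`cos Θ`, which vanishes at `z = 1`, and by reduction of order by
`cos Θ ∫₀ᶻ cos⁻² Θ = sin Θ / Θ' + cos Θ ∫₀ᶻ t² sin² Θ / Θ'²`; their sum is positive on `[0, 1]`, and
subtracting a small multiple of `z² / 2` makes the inequality strict. -/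
lemma exists_supersolution (h : IsAngleProfile t D Θ) (hD : t ^ 2 < D) :
    ∃ (y y' y'' : ℝ → ℝ) (m : ℝ), 0 < m ∧ (∀ z, HasDerivAt y (y' z) z) ∧
      (∀ z, HasDerivAt y' (y'' z) z) ∧ Continuous y'' ∧
      ∀ z ∈ Icc (0 : ℝ) 1, 0 < y z ∧
        m ≤ -y'' z - (speed t D (Θ z) ^ 2 + t ^ 2 * Real.sin (Θ z) ^ 2) * y z := by
  have hD0 : 0 < D := (sq_nonneg t).trans_lt hD
  have hΘ := h.continuous
  have hS : Continuous fun z => speed t D (Θ z) := (continuous_speed t D).comp hΘ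
  have hS0 : ∀ z, speed t D (Θ z) ≠ 0 := fun z => (speed_pos hD _).ne'
  set A : ℝ → ℝ := fun z =>
    ∫ u in (0 : ℝ)..z, t ^ 2 * Real.sin (Θ u) ^ 2 / speed t D (Θ u) ^ 2 with hA
  have hAc : Continuous fun u => t ^ 2 * Real.sin (Θ u) ^ 2 / speed t D (Θ u) ^ 2 :=
    Continuous.div (by fun_prop) (by fun_prop) fun z => pow_ne_zero 2 (hS0 z)
  have hA' : ∀ z, HasDerivAt A (t ^ 2 * Real.sin (Θ z) ^ 2 / speed t D (Θ z) ^ 2) z := fun z =>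
    (hAc.integral_hasStrictDerivAt 0 z).hasDerivAt
  have hAcont : Continuous A := continuous_iff_continuousAt.2 fun z => (hA' z).continuousAt
  set m := min 1 (1 / √D) with hm
  have hm0 : 0 < m := lt_min one_pos (by positivity)
  refine ⟨fun z => Real.cos (Θ z) * (1 + A z) + Real.sin (Θ z) / speed t D (Θ z) - m / 2 * z ^ 2,
    fun z => -Real.sin (Θ z) * speed t D (Θ z) * (1 + A z) + Real.cos (Θ z) - m * z,
    fun z => -(speed t D (Θ z) ^ 2 + t ^ 2 * Real.sin (Θ z) ^ 2) *
      (Real.cos (Θ z) * (1 + A z) + Real.sin (Θ z) / speed t D (Θ z)) - m, m, hm0, ?_, ?_, ?_, ?_⟩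
  · intro z
    have h2 : HasDerivAt (fun z : ℝ => m / 2 * z ^ 2) (m / 2 * (2 * z)) z := by
      simpa using (hasDerivAt_pow 2 z).const_mul (m / 2)
    refine ((((h.hasDerivAt_cos z).mul ((hA' z).const_add 1)).add
      ((h.hasDerivAt_sin z).div (h.hasDerivAt_speed hD z) (hS0 z))).sub h2).congr_deriv ?_
    have := hS0 z
    field_simp
    ring
  · intro z
    refine (((((h.hasDerivAt_sin z).neg.mul (h.hasDerivAt_speed hD z)).mul
      ((hA' z).const_add 1)).add (h.hasDerivAt_cos z)).sub
      ((hasDerivAt_id z).const_mul m)).congr_deriv ?_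
    have := hS0 z
    simp only [Pi.neg_apply, Pi.mul_apply]
    field_simp
    ring
  · exact Continuous.sub (Continuous.mul (by fun_prop) (Continuous.add (by fun_prop)
      (Continuous.div (by fun_prop) hS hS0))) continuous_const
  · intro z hz
    obtain ⟨hz0, hz1⟩ := h.mem_Icc hD hz
    have hc : 0 ≤ Real.cos (Θ z) := Real.cos_nonneg_of_mem_Icc ⟨by linarith [Real.pi_pos], hz1⟩
    have hs : 0 ≤ Real.sin (Θ z) := Real.sin_nonneg_of_nonneg_of_le_pi hz0 (by linarith)
    have hcs : 1 ≤ Real.cos (Θ z) + Real.sin (Θ z) := by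
      nlinarith [Real.sin_sq_add_cos_sq (Θ z), mul_nonneg hc hs]
    have hA0 : 0 ≤ A z := intervalIntegral.integral_nonneg hz.1 fun u _ => by positivity
    have hinv : m ≤ 1 / speed t D (Θ z) := by
      refine (min_le_right _ _).trans (one_div_le_one_div_of_le (speed_pos hD _)
        (Real.sqrt_le_sqrt ?_))
      have : 0 ≤ t ^ 2 * Real.cos (Θ z) ^ 2 := by positivity
      linarith
    have hy0 : m ≤ Real.cos (Θ z) * (1 + A z) + Real.sin (Θ z) / speed t D (Θ z) := by
      have h1 : Real.cos (Θ z) * m ≤ Real.cos (Θ z) * (1 + A z) :=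
        mul_le_mul_of_nonneg_left ((min_le_left _ _).trans (by linarith)) hc
      have h2 : Real.sin (Θ z) * m ≤ Real.sin (Θ z) / speed t D (Θ z) := by
        rw [div_eq_mul_one_div]
        exact mul_le_mul_of_nonneg_left hinv hs
      nlinarith
    have hzz : z ^ 2 ≤ 1 := pow_le_one₀ hz.1 hz.2
    refine ⟨by nlinarith, ?_⟩
    have : 0 ≤ (speed t D (Θ z) ^ 2 + t ^ 2 * Real.sin (Θ z) ^ 2) * (m / 2 * z ^ 2) := by
      positivity
    nlinarith

/-- The logarithmic derivative `w = -y' / y` of a strict supersolution `y` is bounded on `[0, 1]`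
and satisfies a strict Riccati inequality. -/
theorem exists_riccati (h : IsAngleProfile t D Θ) (hD : t ^ 2 < D) :
    ∃ (w w' : ℝ → ℝ) (μ : ℝ), 0 < μ ∧ (∀ z ∈ Icc (0 : ℝ) 1, HasDerivAt w (w' z) z) ∧
      ContinuousOn w' (Icc 0 1) ∧ ∀ z ∈ Icc (0 : ℝ) 1,
        μ ≤ w' z - w z ^ 2 - (speed t D (Θ z) ^ 2 + t ^ 2 * Real.sin (Θ z) ^ 2) := by
  obtain ⟨y, y', y'', m, hm, hy, hy', hy'', hpos⟩ := h.exists_supersolution hD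
  have hyc : Continuous y := continuous_iff_continuousAt.2 fun z => (hy z).continuousAt
  have hyc' : Continuous y' := continuous_iff_continuousAt.2 fun z => (hy' z).continuousAt
  obtain ⟨M, hM⟩ := isCompact_Icc.exists_bound_of_continuousOn (s := Icc (0 : ℝ) 1) hyc.continuousOn
  have h0 : (0 : ℝ) ∈ Icc (0 : ℝ) 1 := by simp
  have hM0 : 0 < M := ((hpos 0 h0).1.trans_le (le_abs_self _)).trans_le (hM 0 h0)
  refine ⟨fun z => -(y' z / y z), fun z => -((y'' z * y z - y' z * y' z) / y z ^ 2), m / M,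
    div_pos hm hM0, fun z hz => ((hy' z).div (hy z) (hpos z hz).1.ne').neg, ?_, fun z hz => ?_⟩
  · exact (ContinuousOn.div (by fun_prop) (by fun_prop)
      fun z hz => pow_ne_zero 2 (hpos z hz).1.ne').neg
  · obtain ⟨hyz, hmz⟩ := hpos z hz
    have hle : y z ≤ M := (le_abs_self _).trans (hM z hz)
    have heq : -((y'' z * y z - y' z * y' z) / y z ^ 2) - (-(y' z / y z)) ^ 2 -
        (speed t D (Θ z) ^ 2 + t ^ 2 * Real.sin (Θ z) ^ 2) =
        (-y'' z - (speed t D (Θ z) ^ 2 + t ^ 2 * Real.sin (Θ z) ^ 2) * y z) / y z := by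
      field_simp
      ring
    rw [heq]
    calc m / M ≤ m / y z := div_le_div_of_nonneg_left hm.le hyz hle
      _ ≤ _ := div_le_div_of_nonneg_right hmz hyz.le

end IsAngleProfile

/-! ### Convergence in `L²` -/

/-- The sequence `f` of `L²` functions converges in `L²(μ)` to the `L²` function `F`. -/
structure TendstoL2 {α E : Type*} [MeasurableSpace α] [NormedAddCommGroup E] (μ : Measure α)
    (f : ℕ → α → E) (F : α → E) : Prop where
  memLp : ∀ j, MemLp (f j) 2 μ
  memLp_lim : MemLp F 2 μ
  tendsto : Tendsto (fun j => eLpNorm (f j - F) 2 μ) atTop (𝓝 0)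

namespace TendstoL2

variable {α E : Type*} [MeasurableSpace α] [NormedAddCommGroup E] {μ : Measure α}
  {f g : ℕ → α → E} {F G : α → E}

lemma const (hF : MemLp F 2 μ) : TendstoL2 μ (fun _ => F) F :=
  ⟨fun _ => hF, hF, by simp⟩

lemma add (hf : TendstoL2 μ f F) (hg : TendstoL2 μ g G) :
    TendstoL2 μ (fun j => f j + g j) (F + G) := by
  refine ⟨fun j => (hf.memLp j).add (hg.memLp j), hf.memLp_lim.add hg.memLp_lim, ?_⟩
  refine tendsto_of_tendsto_of_tendsto_of_le_of_le tendsto_const_nhds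
    (by simpa using hf.tendsto.add hg.tendsto) (fun _ => zero_le) fun j => ?_
  rw [add_sub_add_comm]
  exact eLpNorm_add_le ((hf.memLp j).sub hf.memLp_lim).1 ((hg.memLp j).sub hg.memLp_lim).1
    (by norm_num)

lemma neg (hf : TendstoL2 μ f F) : TendstoL2 μ (fun j => -f j) (-F) := by
  refine ⟨fun j => (hf.memLp j).neg, hf.memLp_lim.neg, ?_⟩
  simpa only [neg_sub_neg, eLpNorm_sub_comm] using hf.tendsto

lemma sub (hf : TendstoL2 μ f F) (hg : TendstoL2 μ g G) :
    TendstoL2 μ (fun j => f j - g j) (F - G) := by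
  simpa only [sub_eq_add_neg] using hf.add hg.neg

lemma congr (hf : TendstoL2 μ f F) (hfg : ∀ j, f j =ᵐ[μ] g j) (hFG : F =ᵐ[μ] G) :
    TendstoL2 μ g G := by
  refine ⟨fun j => (memLp_congr_ae (hfg j)).1 (hf.memLp j), (memLp_congr_ae hFG).1 hf.memLp_lim, ?_⟩
  exact hf.tendsto.congr fun j => eLpNorm_congr_ae ((hfg j).sub hFG)

lemma bdd_smul [NormedSpace ℝ E] (hf : TendstoL2 μ f F) {c : α → ℝ} {C : ℝ}
    (hc : AEStronglyMeasurable c μ) (hC : ∀ᵐ x ∂μ, ‖c x‖ ≤ C) :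
    TendstoL2 μ (fun j x => c x • f j x) (fun x => c x • F x) := by
  have hmem : MemLp c ⊤ μ := memLp_top_of_bound hc C hC
  have hle : ∀ u : α → E, eLpNorm (fun x => c x • u x) 2 μ ≤ ENNReal.ofReal C * eLpNorm u 2 μ := by
    intro u
    refine eLpNorm_le_mul_eLpNorm_of_ae_le_mul ?_ 2
    filter_upwards [hC] with x hx
    rw [norm_smul]
    exact mul_le_mul_of_nonneg_right hx (norm_nonneg _)
  refine ⟨fun j => (hf.memLp j).smul hmem, hf.memLp_lim.smul hmem, ?_⟩
  refine tendsto_of_tendsto_of_tendsto_of_le_of_le tendsto_const_nhds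
    (by simpa using ENNReal.Tendsto.const_mul (a := ENNReal.ofReal C) hf.tendsto (by simp))
    (fun _ => zero_le) fun j => ?_
  refine le_trans (le_of_eq ?_) (hle (f j - F))
  congr 1
  ext x
  simp [smul_sub]

lemma tendsto_integral_inner [InnerProductSpace ℝ E] (hf : TendstoL2 μ f F)
    (hg : TendstoL2 μ g G) :
    Tendsto (fun j => ∫ x, inner ℝ (f j x) (g j x) ∂μ) atTop (𝓝 (∫ x, inner ℝ (F x) (G x) ∂μ)) := by
  have h1 := (Lp.tendsto_Lp_iff_tendsto_eLpNorm'' f hf.memLp F hf.memLp_lim).2 hf.tendsto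
  have h2 := (Lp.tendsto_Lp_iff_tendsto_eLpNorm'' g hg.memLp G hg.memLp_lim).2 hg.tendsto
  have key : ∀ {u v : α → E} (hu : MemLp u 2 μ) (hv : MemLp v 2 μ),
      inner ℝ (hu.toLp u) (hv.toLp v) = ∫ x, inner ℝ (u x) (v x) ∂μ := fun hu hv => by
    rw [L2.inner_def]
    refine integral_congr_ae ?_
    filter_upwards [hu.coeFn_toLp, hv.coeFn_toLp] with x hx hx'
    rw [hx, hx']
  simpa only [key] using h1.inner (𝕜 := ℝ) h2

end TendstoL2

lemma integrable_inner_of_memLp {α E : Type*} [MeasurableSpace α] [NormedAddCommGroup E]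
    [InnerProductSpace ℝ E] {μ : Measure α} {F G : α → E} (hF : MemLp F 2 μ) (hG : MemLp G 2 μ) :
    Integrable (fun x => inner ℝ (F x) (G x)) μ := by
  refine (L2.integrable_inner (𝕜 := ℝ) (hF.toLp F) (hG.toLp G)).congr ?_
  filter_upwards [hF.coeFn_toLp, hG.coeFn_toLp] with x hx hx'
  rw [hx, hx']

/-! ### Integration by parts in the cell -/

/-- The divergence theorem on a box for a vector field with one nonzero component. -/
lemma integral_partialDeriv_box {a b : Fin 3 → ℝ} (hab : a ≤ b) (i : Fin 3) {f : Pt → ℝ}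
    (hd : ∀ x ∈ Icc a b, DifferentiableAt ℝ f x) (hc : ContinuousOn (partialDeriv i f) (Icc a b)) :
    ∫ x in box a b, partialDeriv i f x =
      (∫ y in box (i.removeNth a) (i.removeNth b), f (i.insertNth (α := fun _ => ℝ) (b i) y)) -
        ∫ y in box (i.removeNth a) (i.removeNth b),
          f (i.insertNth (α := fun _ => ℝ) (a i) y) := by
  have hsum : ∀ x, ∑ j, (if j = i then fderiv ℝ f x else 0) (Pi.single j 1) =
      partialDeriv i f x := fun x => by
    rw [Finset.sum_eq_single i]
    · simp [partialDeriv]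
    · intro j _ hj
      simp [hj]
    · simp
  have key := integral_divergence_of_hasFDerivAt_off_countable' a b hab
    (fun j => if j = i then f else 0) (fun j x => if j = i then fderiv ℝ f x else 0) ∅
    countable_empty ?_ ?_ ?_
  · rw [Finset.sum_eq_single i (fun j _ hj => by simp [hj]) (by simp)] at key
    simp only [hsum, if_true] at key
    simp only [setIntegral_congr_set (box_ae_eq_Icc _ _)]
    exact key
  · intro j
    split_ifs
    · exact fun x hx => (hd x hx).continuousAt.continuousWithinAt
    · exact continuousOn_const
  · intro x hx j
    split_ifs
    · exact (hd x (box_subset_Icc a b hx.1)).hasFDerivAt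
    · exact hasFDerivAt_const 0 x
  · simp only [hsum]
    exact hc.integrableOn_compact isCompact_Icc

/-- Integration by parts for `W^{1,2}` limits, when one factor has zero trace on the two faces
`x i = a i` and `x i = b i`. -/
theorem integral_inner_add_inner_eq_zero {a b : Fin 3 → ℝ} (hab : a ≤ b) (i : Fin 3)
    {f g : ℕ → Pt → Vec} {F F' G G' : Pt → Vec}
    (hfd : ∀ j, ∀ x ∈ Icc a b, DifferentiableAt ℝ (f j) x)
    (hgd : ∀ j, ∀ x ∈ Icc a b, DifferentiableAt ℝ (g j) x)
    (hfc : ∀ j, ContinuousOn (partialDeriv i (f j)) (Icc a b))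
    (hgc : ∀ j, ContinuousOn (partialDeriv i (g j)) (Icc a b))
    (hf : TendstoL2 (volume.restrict (box a b)) f F)
    (hf' : TendstoL2 (volume.restrict (box a b)) (fun j => partialDeriv i (f j)) F')
    (hg : TendstoL2 (volume.restrict (box a b)) g G)
    (hg' : TendstoL2 (volume.restrict (box a b)) (fun j => partialDeriv i (g j)) G')
    {φ : ℝ → (Fin 2 → ℝ) → Vec}
    (hfφ : ∀ c ∈ ({a i, b i} : Set ℝ),
      TendstoL2 (volume.restrict (box (i.removeNth a) (i.removeNth b)))
        (fun j y => f j (i.insertNth (α := fun _ => ℝ) c y)) (φ c))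
    (hg0 : ∀ c ∈ ({a i, b i} : Set ℝ),
      TendstoL2 (volume.restrict (box (i.removeNth a) (i.removeNth b)))
        (fun j y => g j (i.insertNth (α := fun _ => ℝ) c y)) 0) :
    ∫ x in box a b, (inner ℝ (F' x) (G x) + inner ℝ (F x) (G' x)) = 0 := by
  have hleft : Tendsto (fun j => ∫ x in box a b,
      (inner ℝ (partialDeriv i (f j) x) (g j x) + inner ℝ (f j x) (partialDeriv i (g j) x))) atTop
      (𝓝 (∫ x in box a b, (inner ℝ (F' x) (G x) + inner ℝ (F x) (G' x)))) := by
    rw [integral_add (integrable_inner_of_memLp hf'.memLp_lim hg.memLp_lim)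
      (integrable_inner_of_memLp hf.memLp_lim hg'.memLp_lim)]
    refine ((hf'.tendsto_integral_inner hg).add (hf.tendsto_integral_inner hg')).congr fun j => ?_
    rw [integral_add (integrable_inner_of_memLp (hf'.memLp j) (hg.memLp j))
      (integrable_inner_of_memLp (hf.memLp j) (hg'.memLp j))]
  have hright : ∀ c ∈ ({a i, b i} : Set ℝ), Tendsto (fun j =>
      ∫ y in box (i.removeNth a) (i.removeNth b),
        inner ℝ (f j (i.insertNth (α := fun _ => ℝ) c y)) (g j (i.insertNth (α := fun _ => ℝ) c y)))
      atTop (𝓝 0) := fun c hc => by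
    simpa using (hfφ c hc).tendsto_integral_inner (hg0 c hc)
  refine tendsto_nhds_unique hleft ?_
  have hsub := (hright (b i) (by simp)).sub (hright (a i) (by simp))
  rw [sub_zero] at hsub
  refine hsub.congr fun j => ?_
  have hpd : ∀ x ∈ Icc a b, partialDeriv i (fun x => inner ℝ (f j x) (g j x)) x =
      inner ℝ (partialDeriv i (f j) x) (g j x) + inner ℝ (f j x) (partialDeriv i (g j) x) := by
    intro x hx
    rw [partialDeriv, fderiv_inner_apply ℝ (hfd j x hx) (hgd j x hx), add_comm]
    rfl
  have hfcont : ContinuousOn (f j) (Icc a b) := fun x hx =>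
    (hfd j x hx).continuousAt.continuousWithinAt
  have hgcont : ContinuousOn (g j) (Icc a b) := fun x hx =>
    (hgd j x hx).continuousAt.continuousWithinAt
  have := integral_partialDeriv_box hab i (f := fun x => inner ℝ (f j x) (g j x))
    (fun x hx => (hfd j x hx).inner ℝ (hgd j x hx))
    ((((hfc j).inner hgcont).add (hfcont.inner (hgc j))).congr hpd)
  rw [← this]
  exact setIntegral_congr_fun (isOpen_box a b).measurableSet fun x hx =>
    hpd x (box_subset_Icc a b hx)

/-! ### Approximation of fields with zero trace on the bottom and the top -/

section PartialDeriv

variable {F : Type*} [NormedAddCommGroup F] [NormedSpace ℝ F] {i : Fin 3} {x : Pt}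

lemma hasFDerivAt_comp_coord {B : ℝ → F} {B' : F} (hB : HasDerivAt B B' (x i)) :
    HasFDerivAt (fun x : Pt => B (x i))
      ((ContinuousLinearMap.toSpanSingleton ℝ B').comp (ContinuousLinearMap.proj i)) x :=
  hB.hasFDerivAt.comp x (ContinuousLinearMap.proj (R := ℝ) (φ := fun _ : Fin 3 => ℝ) i).hasFDerivAt

lemma partialDeriv_comp_coord {B : ℝ → F} {B' : F} (hB : HasDerivAt B B' (x i)) :
    partialDeriv i (fun x : Pt => B (x i)) x = B' := by
  rw [partialDeriv, (hasFDerivAt_comp_coord hB).fderiv]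
  simp

lemma partialDeriv_coord_smul {c : ℝ → ℝ} {c' : ℝ} {v : Pt → F} (hc : HasDerivAt c c' (x i))
    (hv : DifferentiableAt ℝ v x) :
    partialDeriv i (fun x : Pt => c (x i) • v x) x = c' • v x + c (x i) • partialDeriv i v x := by
  rw [partialDeriv, fderiv_fun_smul (hasFDerivAt_comp_coord hc).differentiableAt hv, partialDeriv,
    (hasFDerivAt_comp_coord hc).fderiv]
  simp [add_comm]

lemma partialDeriv_add {u v : Pt → F} (hu : DifferentiableAt ℝ u x) (hv : DifferentiableAt ℝ v x) :
    partialDeriv i (fun x => u x + v x) x = partialDeriv i u x + partialDeriv i v x := by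
  rw [partialDeriv, fderiv_fun_add hu hv]
  rfl

lemma partialDeriv_sub {u v : Pt → F} (hu : DifferentiableAt ℝ u x) (hv : DifferentiableAt ℝ v x) :
    partialDeriv i (fun x => u x - v x) x = partialDeriv i u x - partialDeriv i v x := by
  rw [partialDeriv, fderiv_fun_sub hu hv]
  rfl

end PartialDeriv

lemma TendstoL2.coord_smul {a b : Fin 3 → ℝ} {i : Fin 3} {f : ℕ → Pt → Vec} {F : Pt → Vec}
    (hf : TendstoL2 (volume.restrict (box a b)) f F) {c : ℝ → ℝ}
    (hc : ContinuousOn c (Icc (a i) (b i))) :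
    TendstoL2 (volume.restrict (box a b)) (fun j x => c (x i) • f j x) (fun x => c (x i) • F x) := by
  obtain ⟨C, hC⟩ := isCompact_Icc.exists_bound_of_continuousOn hc
  have hmaps : MapsTo (fun x : Pt => x i) (Icc a b) (Icc (a i) (b i)) := fun x hx =>
    ⟨hx.1 i, hx.2 i⟩
  have hcc : ContinuousOn (fun x : Pt => c (x i)) (Icc a b) :=
    hc.comp (continuous_apply i).continuousOn hmaps
  refine hf.bdd_smul (C := C) (memLp_of_continuousOn_Icc hcc 2).1 ?_
  filter_upwards [ae_restrict_mem (isOpen_box a b).measurableSet] with x hx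
  exact hC _ (hmaps (box_subset_Icc a b hx))

lemma continuous_insertNth (i : Fin 3) (c : ℝ) :
    Continuous fun y : Fin 2 → ℝ => (i.insertNth (α := fun _ => ℝ) c y : Pt) := by
  fun_prop

/-- Let `n` have the same traces as the `C¹` function `N` on the faces `z = 0` and `z = 1`. The trace
on each face comes with its own approximating sequence; interpolating linearly in `z` between the
two gives one sequence of `C¹` functions that converges to `n - N` in `W^{1,2}` and whose
restrictions to both faces converge to `0`. -/
theorem exists_approx_zero_trace {L₁ L₂ : ℝ} {n N : Pt → Vec} {g₀ g₁ : (Fin 2 → ℝ) → Vec}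
    (hn : MemW12 (cell L₁ L₂) n) (hN : ContDiff ℝ 1 N)
    (h₀ : HasFaceTrace (lo L₁ L₂) (hi L₁ L₂) n 2 0 g₀)
    (h₁ : HasFaceTrace (lo L₁ L₂) (hi L₁ L₂) n 2 1 g₁)
    (hN₀ : ∀ y, N ((2 : Fin 3).insertNth (α := fun _ => ℝ) 0 y) = g₀ y)
    (hN₁ : ∀ y, N ((2 : Fin 3).insertNth (α := fun _ => ℝ) 1 y) = g₁ y) :
    ∃ u : ℕ → Pt → Vec, (∀ j, ContDiff ℝ 1 (u j)) ∧
      TendstoL2 (volume.restrict (cell L₁ L₂)) u (n - N) ∧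
      TendstoL2 (volume.restrict (cell L₁ L₂)) (fun j => partialDeriv 2 (u j))
        (weakPartial (cell L₁ L₂) 2 n - partialDeriv 2 N) ∧
      ∀ c ∈ ({lo L₁ L₂ 2, hi L₁ L₂ 2} : Set ℝ), TendstoL2 (volume.restrict
        (box ((2 : Fin 3).removeNth (lo L₁ L₂)) ((2 : Fin 3).removeNth (hi L₁ L₂))))
        (fun j y => u j ((2 : Fin 3).insertNth (α := fun _ => ℝ) c y)) 0 := by
  obtain ⟨hg₀, v, hv, hvn, hvd, hv₀⟩ := h₀
  obtain ⟨hg₁, v', hv', hvn', hvd', hv₁⟩ := h₁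
  have hmem : ∀ {f : Pt → Vec}, Continuous f → MemLp f 2 (volume.restrict (cell L₁ L₂)) :=
    fun hf => memLp_of_continuousOn_Icc hf.continuousOn 2
  have hlim : ∀ {v : ℕ → Pt → Vec}, (∀ k, ContDiff ℝ 1 (v k)) →
      Tendsto (fun k => eLpNorm (v k - n) 2 (volume.restrict (cell L₁ L₂))) atTop (𝓝 0) →
      TendstoL2 (volume.restrict (cell L₁ L₂)) v n := fun hv hvn =>
    ⟨fun k => hmem (hv k).continuous, hn.1, hvn⟩
  have hlim' : ∀ {v : ℕ → Pt → Vec}, (∀ k, ContDiff ℝ 1 (v k)) →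
      Tendsto (fun k => eLpNorm (partialDeriv 2 (v k) - weakPartial (cell L₁ L₂) 2 n) 2
        (volume.restrict (cell L₁ L₂))) atTop (𝓝 0) →
      TendstoL2 (volume.restrict (cell L₁ L₂)) (fun k => partialDeriv 2 (v k))
        (weakPartial (cell L₁ L₂) 2 n) := fun hv hvd =>
    ⟨fun k => hmem (continuous_partialDeriv (hv k)), (hn.weakPartial_spec 2).1, hvd⟩
  have hc : ContinuousOn (fun s : ℝ => 1 - s) (Icc (lo L₁ L₂ 2) (hi L₁ L₂ 2)) := by fun_prop
  have hc' : ContinuousOn (fun s : ℝ => s) (Icc (lo L₁ L₂ 2) (hi L₁ L₂ 2)) := by fun_prop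
  have hdiff : ∀ {f : Pt → Vec}, ContDiff ℝ 1 f → ∀ x, DifferentiableAt ℝ f x := fun hf x =>
    hf.differentiable one_ne_zero x
  have hcoord : ContDiff ℝ 1 fun x : Pt => x 2 := by fun_prop
  refine ⟨fun k x => ((1 - x 2) • v k x + x 2 • v' k x) - N x, fun k => ?_, ?_, ?_, ?_⟩
  · exact (((contDiff_const.sub hcoord).smul (hv k)).add (hcoord.smul (hv' k))).sub hN
  · refine ((((hlim hv hvn).coord_smul hc).add ((hlim hv' hvn').coord_smul hc')).sub
      (TendstoL2.const (hmem hN.continuous))).congr (fun k => EventuallyEq.rfl)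
      (Eventually.of_forall fun x => ?_)
    simp only [Pi.sub_apply, Pi.add_apply]
    module
  · refine (((((hlim' hv (hvd 2)).coord_smul hc).add ((hlim' hv' (hvd' 2)).coord_smul hc')).add
      ((hlim hv' hvn').sub (hlim hv hvn))).sub
      (TendstoL2.const (hmem (continuous_partialDeriv (i := 2) hN)))).congr
      (fun k => Eventually.of_forall fun x => ?_) (Eventually.of_forall fun x => ?_)
    · have h1 := partialDeriv_coord_smul (i := 2) (x := x) (v := v k)
        ((hasDerivAt_id (x 2)).const_sub 1) (hdiff (hv k) x)
      have h2 := partialDeriv_coord_smul (i := 2) (x := x) (v := v' k)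
        (hasDerivAt_id (x 2)) (hdiff (hv' k) x)
      have hd1 : DifferentiableAt ℝ (fun x : Pt => (1 - x 2) • v k x) x :=
        hdiff ((contDiff_const.sub hcoord).smul (hv k)) x
      have hd2 : DifferentiableAt ℝ (fun x : Pt => x 2 • v' k x) x :=
        hdiff (hcoord.smul (hv' k)) x
      simp only [id] at h1 h2
      refine Eq.trans ?_ (partialDeriv_sub (i := 2) (hd1.fun_add hd2) (hdiff hN x)).symm
      rw [partialDeriv_add hd1 hd2, h1, h2]
      simp only [Pi.sub_apply, Pi.add_apply]
      module
    · simp only [Pi.sub_apply, Pi.add_apply]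
      module
  · have hface : ∀ {v : ℕ → Pt → Vec} {g : (Fin 2 → ℝ) → Vec} {c : ℝ}, (∀ k, ContDiff ℝ 1 (v k)) →
        MemLp g 2 (volume.restrict (box ((2 : Fin 3).removeNth (lo L₁ L₂))
          ((2 : Fin 3).removeNth (hi L₁ L₂)))) →
        Tendsto (fun k => eLpNorm (fun y : Fin 2 → ℝ =>
            v k ((2 : Fin 3).insertNth (α := fun _ => ℝ) c y) - g y) 2
          (volume.restrict (box ((2 : Fin 3).removeNth (lo L₁ L₂))
            ((2 : Fin 3).removeNth (hi L₁ L₂))))) atTop (𝓝 0) →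
        TendstoL2 (volume.restrict (box ((2 : Fin 3).removeNth (lo L₁ L₂))
          ((2 : Fin 3).removeNth (hi L₁ L₂))))
          (fun k y => v k ((2 : Fin 3).insertNth (α := fun _ => ℝ) c y)) g := fun hv hg hvg =>
      ⟨fun k => memLp_of_continuousOn_Icc
        ((hv k).continuous.comp (continuous_insertNth 2 _)).continuousOn 2, hg, hvg⟩
    have hlo : lo L₁ L₂ 2 = 0 := rfl
    have hhi : hi L₁ L₂ 2 = 1 := rfl
    rintro c (rfl | rfl)
    · rw [hlo]
      refine ((hface hv hg₀ hv₀).sub (TendstoL2.const hg₀)).congr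
        (fun k => Eventually.of_forall fun y => ?_) (Eventually.of_forall fun y => ?_)
      · simp [hN₀]
      · simp
    · rw [hhi]
      refine ((hface hv' hg₁ hv₁).sub (TendstoL2.const hg₁)).congr
        (fun k => Eventually.of_forall fun y => ?_) (Eventually.of_forall fun y => ?_)
      · simp [hN₁]
      · simp

section ZeroTrace

variable {L₁ L₂ : ℝ} {u : ℕ → Pt → Vec} {h k : Pt → Vec}

lemma lo_le_hi (hL₁ : 0 < L₁) (hL₂ : 0 < L₂) : lo L₁ L₂ ≤ hi L₁ L₂ := by
  intro i
  fin_cases i <;> simp [lo, hi] <;> linarith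

/-- The null Lagrangian `∂_z (b(z) · h)`. -/
lemma integral_linear_eq_zero (hL₁ : 0 < L₁) (hL₂ : 0 < L₂) (hu : ∀ j, ContDiff ℝ 1 (u j))
    (hh : TendstoL2 (volume.restrict (cell L₁ L₂)) u h)
    (hk : TendstoL2 (volume.restrict (cell L₁ L₂)) (fun j => partialDeriv 2 (u j)) k)
    (h0 : ∀ c ∈ ({lo L₁ L₂ 2, hi L₁ L₂ 2} : Set ℝ), TendstoL2 (volume.restrict
        (box ((2 : Fin 3).removeNth (lo L₁ L₂)) ((2 : Fin 3).removeNth (hi L₁ L₂))))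
        (fun j y => u j ((2 : Fin 3).insertNth (α := fun _ => ℝ) c y)) 0)
    {b b' : ℝ → Vec} (hb : ∀ z, HasDerivAt b (b' z) z) (hb' : Continuous b') :
    Integrable (fun x => inner ℝ (b' (x 2)) (h x) + inner ℝ (b (x 2)) (k x))
      (volume.restrict (cell L₁ L₂)) ∧
    ∫ x in cell L₁ L₂, (inner ℝ (b' (x 2)) (h x) + inner ℝ (b (x 2)) (k x)) = 0 := by
  have hbc : Continuous b := continuous_iff_continuousAt.2 fun z => (hb z).continuousAt
  have hpd : partialDeriv 2 (fun x : Pt => b (x 2)) = fun x => b' (x 2) :=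
    funext fun x => partialDeriv_comp_coord (hb (x 2))
  have hL2 : ∀ {c : ℝ → Vec}, Continuous c → TendstoL2 (volume.restrict (cell L₁ L₂))
      (fun _ (x : Pt) => c (x 2)) (fun x => c (x 2)) := fun hc =>
    TendstoL2.const (memLp_of_continuousOn_Icc (hc.comp (continuous_apply 2)).continuousOn 2)
  refine ⟨(integrable_inner_of_memLp (hL2 hb').memLp_lim hh.memLp_lim).add
    (integrable_inner_of_memLp (hL2 hbc).memLp_lim hk.memLp_lim), ?_⟩
  refine integral_inner_add_inner_eq_zero (lo_le_hi hL₁ hL₂) 2 (f := fun _ x => b (x 2)) (g := u)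
    (F := fun x => b (x 2)) (F' := fun x => b' (x 2)) (G := h) (G' := k)
    (φ := fun c _ => b c)
    (fun _ x _ => (hasFDerivAt_comp_coord (hb (x 2))).differentiableAt)
    (fun j x _ => (hu j).differentiable one_ne_zero x) (fun _ => ?_)
    (fun j => (continuous_partialDeriv (hu j)).continuousOn) (hL2 hbc) ?_ hh hk (fun c _ => ?_) h0
  · rw [hpd]
    exact (hb'.comp (continuous_apply 2)).continuousOn
  · rw [hpd]
    exact hL2 hb'
  · simp only [Fin.insertNth_apply_same]
    exact TendstoL2.const (memLp_const _)

/-- The null Lagrangian `∂_z (w(z) |h|²)`. -/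
lemma integral_quadratic_eq_zero (hL₁ : 0 < L₁) (hL₂ : 0 < L₂) (hu : ∀ j, ContDiff ℝ 1 (u j))
    (hh : TendstoL2 (volume.restrict (cell L₁ L₂)) u h)
    (hk : TendstoL2 (volume.restrict (cell L₁ L₂)) (fun j => partialDeriv 2 (u j)) k)
    (h0 : ∀ c ∈ ({lo L₁ L₂ 2, hi L₁ L₂ 2} : Set ℝ), TendstoL2 (volume.restrict
        (box ((2 : Fin 3).removeNth (lo L₁ L₂)) ((2 : Fin 3).removeNth (hi L₁ L₂))))
        (fun j y => u j ((2 : Fin 3).insertNth (α := fun _ => ℝ) c y)) 0)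
    {w w' : ℝ → ℝ} (hw : ∀ z ∈ Icc (0 : ℝ) 1, HasDerivAt w (w' z) z)
    (hw' : ContinuousOn w' (Icc 0 1)) :
    Integrable (fun x => w' (x 2) * inner ℝ (h x) (h x) + 2 * w (x 2) * inner ℝ (h x) (k x))
      (volume.restrict (cell L₁ L₂)) ∧
    ∫ x in cell L₁ L₂,
      (w' (x 2) * inner ℝ (h x) (h x) + 2 * w (x 2) * inner ℝ (h x) (k x)) = 0 := by
  have hwc : ContinuousOn w (Icc 0 1) := fun z hz => (hw z hz).continuousAt.continuousWithinAt
  have hmaps : MapsTo (fun x : Pt => x 2) (Icc (lo L₁ L₂) (hi L₁ L₂)) (Icc 0 1) := fun x hx =>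
    ⟨hx.1 2, hx.2 2⟩
  have hdu : ∀ j x, DifferentiableAt ℝ (u j) x := fun j x => (hu j).differentiable one_ne_zero x
  have hpd : ∀ j, ∀ x ∈ Icc (lo L₁ L₂) (hi L₁ L₂),
      partialDeriv 2 (fun x : Pt => w (x 2) • u j x) x =
        w' (x 2) • u j x + w (x 2) • partialDeriv 2 (u j) x := fun j x hx =>
    partialDeriv_coord_smul (hw _ (hmaps hx)) (hdu j x)
  have hcomp : ∀ {f : ℝ → ℝ}, ContinuousOn f (Icc 0 1) →
      ContinuousOn (fun x : Pt => f (x 2)) (Icc (lo L₁ L₂) (hi L₁ L₂)) := fun hf =>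
    hf.comp (continuous_apply 2).continuousOn hmaps
  have hwh := hh.coord_smul (i := 2) hwc
  have hwk := (hh.coord_smul (i := 2) hw').add (hk.coord_smul (i := 2) hwc)
  have hform : ∀ x, w' (x 2) * inner ℝ (h x) (h x) + 2 * w (x 2) * inner ℝ (h x) (k x) =
      inner ℝ (w' (x 2) • h x + w (x 2) • k x) (h x) + inner ℝ (w (x 2) • h x) (k x) := by
    intro x
    rw [inner_add_left, real_inner_smul_left, real_inner_smul_left, real_inner_smul_left,
      real_inner_comm (h x) (k x)]
    ring
  simp only [hform]
  refine ⟨(integrable_inner_of_memLp hwk.memLp_lim hh.memLp_lim).add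
    (integrable_inner_of_memLp hwh.memLp_lim hk.memLp_lim), ?_⟩
  refine integral_inner_add_inner_eq_zero (lo_le_hi hL₁ hL₂) 2 (f := fun j x => w (x 2) • u j x)
    (g := u) (F := fun x => w (x 2) • h x) (F' := fun x => w' (x 2) • h x + w (x 2) • k x) (G := h)
    (G' := k) (φ := fun _ => 0)
    (fun j x hx => (hasFDerivAt_comp_coord (hw _ (hmaps hx))).differentiableAt.smul (hdu j x))
    (fun j x _ => hdu j x) (fun j => ?_)
    (fun j => (continuous_partialDeriv (hu j)).continuousOn) hwh ?_ hh hk (fun c hc => ?_) h0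
  · exact (((hcomp hw').smul (hu j).continuous.continuousOn).add
      ((hcomp hwc).smul (continuous_partialDeriv (hu j)).continuousOn)).congr (hpd j)
  · refine hwk.congr (fun j => ?_) EventuallyEq.rfl
    filter_upwards [ae_restrict_mem (isOpen_box _ _).measurableSet] with x hx
    exact (hpd j x (box_subset_Icc _ _ hx)).symm
  · refine ((h0 c hc).bdd_smul (c := fun _ => w c) (C := ‖w c‖) (by fun_prop)
      (Eventually.of_forall fun _ => le_rfl)).congr
      (fun j => Eventually.of_forall fun y => ?_) (Eventually.of_forall fun y => ?_)
    · simp only [Fin.insertNth_apply_same]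
    · simp

end ZeroTrace

/-! ### The energy of fields depending only on `z` -/

/-- The energy density of a field with value `a` that depends only on `z`, with `∂_z n = p`. -/
noncomputable def density (t : ℝ) (a p : Vec) : ℝ :=
  ‖p‖ ^ 2 + 2 * t * (a 1 * p 0 - a 0 * p 1) + t ^ 2

lemma norm_sq_vec (a : Vec) : ‖a‖ ^ 2 = a 0 ^ 2 + a 1 ^ 2 + a 2 ^ 2 := by
  rw [EuclideanSpace.real_norm_sq_eq, Fin.sum_univ_three]

lemma inner_vec (a b : Vec) : inner ℝ a b = a 0 * b 0 + a 1 * b 1 + a 2 * b 2 := by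
  rw [PiLp.inner_apply, Fin.sum_univ_three]
  simp [mul_comm]

lemma energy_eq_integral_density {K t L₁ L₂ : ℝ} {n : Pt → Vec} (hn : MemW12 (cell L₁ L₂) n)
    (hz : DependsOnlyOnZ L₁ L₂ n) :
    energy K t L₁ L₂ n =
      K * ∫ x in cell L₁ L₂, density t (n x) (weakPartial (cell L₁ L₂) 2 n x) := by
  rw [energy]
  congr 1
  refine integral_congr_ae ?_
  filter_upwards [hz.weakPartial_eq_zero hn (i := 0) (by decide),
    hz.weakPartial_eq_zero hn (i := 1) (by decide)] with x h0 h1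
  simp only [Fin.sum_univ_three, h0, h1, curl, density, inner_vec, Pi.zero_apply, norm_zero]
  simp
  left
  ring

lemma integrable_density {α : Type*} [MeasurableSpace α] {μ : Measure α} [IsFiniteMeasure μ]
    {t : ℝ} {n g : α → Vec} (hn : MemLp n 2 μ) (hg : MemLp g 2 μ) :
    Integrable (fun x => density t (n x) (g x)) μ := by
  have hcoord : ∀ {f : α → Vec}, MemLp f 2 μ → ∀ i, MemLp (fun x => f x i) 2 μ := fun hf i =>
    (EuclideanSpace.proj i : Vec →L[ℝ] ℝ).comp_memLp' hf
  unfold density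
  exact ((hg.integrable_norm_pow two_ne_zero).add ((((hcoord hn 1).integrable_mul (hcoord hg 0)).sub
    ((hcoord hn 0).integrable_mul (hcoord hg 1))).const_mul (2 * t))).add (integrable_const _)

/-! ### The extremal -/

lemma hasDerivAt_vec {f₀ f₁ f₂ : ℝ → ℝ} {d₀ d₁ d₂ z : ℝ} (h₀ : HasDerivAt f₀ d₀ z)
    (h₁ : HasDerivAt f₁ d₁ z) (h₂ : HasDerivAt f₂ d₂ z) :
    HasDerivAt (fun z => (!₂[f₀ z, f₁ z, f₂ z] : Vec)) !₂[d₀, d₁, d₂] z := by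
  have h : HasDerivAt (fun z => (![f₀ z, f₁ z, f₂ z] : Fin 3 → ℝ)) ![d₀, d₁, d₂] z := by
    rw [hasDerivAt_pi]
    intro i
    fin_cases i
    exacts [h₀, h₁, h₂]
  exact (PiLp.continuousLinearEquiv 2 ℝ (fun _ : Fin 3 => ℝ)).symm.hasFDerivAt.comp_hasDerivAt z h

lemma continuous_vec {f₀ f₁ f₂ : ℝ → ℝ} (h₀ : Continuous f₀) (h₁ : Continuous f₁)
    (h₂ : Continuous f₂) : Continuous fun z => (!₂[f₀ z, f₁ z, f₂ z] : Vec) := by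
  refine (PiLp.continuousLinearEquiv 2 ℝ (fun _ : Fin 3 => ℝ)).symm.continuous.comp
    (continuous_pi fun i => ?_)
  fin_cases i
  exacts [h₀, h₁, h₂]

lemma norm_director (θ φ : ℝ) : ‖director θ φ‖ = 1 := by
  have h : ‖director θ φ‖ ^ 2 = 1 := by
    rw [norm_sq_vec]
    simp only [director, PiLp.toLp_apply, Matrix.cons_val]
    linear_combination (Real.cos θ) ^ 2 * Real.sin_sq_add_cos_sq φ + Real.sin_sq_add_cos_sq θ
  exact (pow_eq_one_iff_of_nonneg (norm_nonneg _) two_ne_zero).1 h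

/-- The derivative of `z ↦ director (Θ z) (t z)` along an angle profile. -/
noncomputable def directorDeriv (t D : ℝ) (Θ : ℝ → ℝ) (z : ℝ) : Vec :=
  !₂[-(t * Real.sin (t * z)) * Real.cos (Θ z) -
      Real.cos (t * z) * Real.sin (Θ z) * speed t D (Θ z),
    t * Real.cos (t * z) * Real.cos (Θ z) -
      Real.sin (t * z) * Real.sin (Θ z) * speed t D (Θ z),
    Real.cos (Θ z) * speed t D (Θ z)]

/-- The derivative of the energy density with respect to `∂_z n` at the extremal `ν`, which is
`2 (ν' + t J ν)` with `J a = (a₁, -a₀, 0)`. -/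
noncomputable def momentum (t D : ℝ) (Θ : ℝ → ℝ) (z : ℝ) : Vec :=
  !₂[-(2 * speed t D (Θ z) * Real.cos (t * z) * Real.sin (Θ z)),
    -(2 * speed t D (Θ z) * Real.sin (t * z) * Real.sin (Θ z)),
    2 * speed t D (Θ z) * Real.cos (Θ z)]

/-- The derivative of `momentum`. -/
noncomputable def momentumDeriv (t D : ℝ) (Θ : ℝ → ℝ) (z : ℝ) : Vec :=
  !₂[-2 * (t ^ 2 * Real.cos (Θ z) * Real.sin (Θ z) * Real.cos (t * z) * Real.sin (Θ z) -
      speed t D (Θ z) * (t * Real.sin (t * z)) * Real.sin (Θ z) +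
      speed t D (Θ z) ^ 2 * Real.cos (t * z) * Real.cos (Θ z)),
    -2 * (t ^ 2 * Real.cos (Θ z) * Real.sin (Θ z) * Real.sin (t * z) * Real.sin (Θ z) +
      speed t D (Θ z) * (t * Real.cos (t * z)) * Real.sin (Θ z) +
      speed t D (Θ z) ^ 2 * Real.sin (t * z) * Real.cos (Θ z)),
    2 * (t ^ 2 * Real.cos (Θ z) * Real.sin (Θ z) * Real.cos (Θ z) -
      speed t D (Θ z) ^ 2 * Real.sin (Θ z))]

namespace IsAngleProfile

variable {t D : ℝ} {Θ : ℝ → ℝ}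

lemma hasDerivAt_director (h : IsAngleProfile t D Θ) (z : ℝ) :
    HasDerivAt (fun z => director (Θ z) (t * z)) (directorDeriv t D Θ z) z := by
  have hl : HasDerivAt (fun z : ℝ => t * z) t z := by simpa using (hasDerivAt_id z).const_mul t
  unfold director directorDeriv
  refine hasDerivAt_vec ((hl.cos.mul (h.hasDerivAt_cos z)).congr_deriv ?_)
    ((hl.sin.mul (h.hasDerivAt_cos z)).congr_deriv ?_) (h.hasDerivAt_sin z) <;> ring

lemma hasDerivAt_momentum (h : IsAngleProfile t D Θ) (hD : t ^ 2 < D) (z : ℝ) :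
    HasDerivAt (momentum t D Θ) (momentumDeriv t D Θ z) z := by
  have hl : HasDerivAt (fun z : ℝ => t * z) t z := by simpa using (hasDerivAt_id z).const_mul t
  have hT := (h.hasDerivAt_speed hD z).const_mul 2
  unfold momentumDeriv
  change HasDerivAt (fun z => momentum t D Θ z) _ z
  unfold momentum
  refine hasDerivAt_vec (((hT.fun_mul hl.cos).fun_mul (h.hasDerivAt_sin z)).neg.congr_deriv ?_)
    (((hT.fun_mul hl.sin).fun_mul (h.hasDerivAt_sin z)).neg.congr_deriv ?_)
    ((hT.fun_mul (h.hasDerivAt_cos z)).congr_deriv ?_) <;> ring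

lemma continuous_comp_speed (h : IsAngleProfile t D Θ) : Continuous fun z => speed t D (Θ z) :=
  (continuous_speed t D).comp h.continuous

lemma continuous_directorDeriv (h : IsAngleProfile t D Θ) : Continuous (directorDeriv t D Θ) := by
  have h1 := h.continuous
  have h2 := h.continuous_comp_speed
  exact continuous_vec (by fun_prop) (by fun_prop) (by fun_prop)

lemma continuous_momentumDeriv (h : IsAngleProfile t D Θ) : Continuous (momentumDeriv t D Θ) := by
  have h1 := h.continuous
  have h2 := h.continuous_comp_speed
  exact continuous_vec (by fun_prop) (by fun_prop) (by fun_prop)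

lemma contDiff_director (h : IsAngleProfile t D Θ) :
    ContDiff ℝ 1 fun x : Pt => director (Θ (x 2)) (t * x 2) := by
  have h1 : ContDiff ℝ 1 fun z => director (Θ z) (t * z) := by
    rw [contDiff_one_iff_deriv]
    refine ⟨fun z => (h.hasDerivAt_director z).differentiableAt, ?_⟩
    rw [show deriv (fun z => director (Θ z) (t * z)) = directorDeriv t D Θ from
      funext fun z => (h.hasDerivAt_director z).deriv]
    exact h.continuous_directorDeriv
  exact h1.comp (contDiff_apply ℝ ℝ (2 : Fin 3))

end IsAngleProfile

/-- The second-order expansion of the energy density about the extremal, with the null Lagrangians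
`∂_z (b · h)`, `b = momentum`, and `∂_z (w |h|²)` split off, where `h = a - ν` and `k = g - ν'`. Since
`|a| = |ν| = 1`, the Euler–Lagrange equation `b' + 2 t J ν' = -2 (Λ - t²) ν`,
`Λ = Θ'² + t² sin² Θ`, turns the first-order term into `-(Λ - t²) |h|²`. What remains is
`|k + t J h + w h|² + t² h₂² + (w' - w² - Λ) |h|²`. -/
lemma density_sub_density_ge {t D : ℝ} {Θ : ℝ → ℝ} {z μ w w' : ℝ} {a g : Vec} (ha : ‖a‖ = 1)
    (hw : μ ≤ w' - w ^ 2 - (speed t D (Θ z) ^ 2 + t ^ 2 * Real.sin (Θ z) ^ 2)) :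
    let h := a - director (Θ z) (t * z)
    let k := g - directorDeriv t D Θ z
    μ * inner ℝ h h + (inner ℝ (momentumDeriv t D Θ z) h + inner ℝ (momentum t D Θ z) k) -
        (w' * inner ℝ h h + 2 * w * inner ℝ h k) ≤
      density t a g - density t (director (Θ z) (t * z)) (directorDeriv t D Θ z) := by
  intro h k
  have ha' : a 0 ^ 2 + a 1 ^ 2 + a 2 ^ 2 = 1 := by rw [← norm_sq_vec, ha, one_pow]
  have hφ := Real.sin_sq_add_cos_sq (t * z)
  have hθ := Real.sin_sq_add_cos_sq (Θ z)
  have hsq : 0 ≤ (k 0 + t * h 1 + w * h 0) ^ 2 + (k 1 - t * h 0 + w * h 1) ^ 2 +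
      (k 2 + w * h 2) ^ 2 + t ^ 2 * h 2 ^ 2 +
      (w' - w ^ 2 - (speed t D (Θ z) ^ 2 + t ^ 2 * Real.sin (Θ z) ^ 2) - μ) *
        (h 0 ^ 2 + h 1 ^ 2 + h 2 ^ 2) := by
    have := mul_nonneg (sub_nonneg.2 hw) (by positivity : 0 ≤ h 0 ^ 2 + h 1 ^ 2 + h 2 ^ 2)
    positivity
  rw [← sub_nonneg]
  refine hsq.trans_eq ?_
  simp only [h, k, density, norm_sq_vec, inner_vec, director, directorDeriv, momentum,
    momentumDeriv, PiLp.sub_apply, PiLp.toLp_apply, Matrix.cons_val]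
  generalize speed t D (Θ z) = T
  generalize Real.sin (Θ z) = s at *
  generalize Real.cos (Θ z) = c at *
  generalize Real.sin (t * z) = S at *
  generalize Real.cos (t * z) = C at *
  linear_combination -(T ^ 2 + t ^ 2 * s ^ 2 - t ^ 2) * (ha' - c ^ 2 * hφ - hθ) +
    2 * s * t ^ 2 * (a 2 - s) * hθ

/-! ### Minimality -/

lemma insertNth_apply_two {i : Fin 3} (hi : i ≠ 2) :
    ∃ l : Fin 2, ∀ (c : ℝ) (y : Fin 2 → ℝ), i.insertNth (α := fun _ => ℝ) c y 2 = y l := by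
  obtain ⟨l, hl⟩ := Fin.exists_succAbove_eq hi.symm
  exact ⟨l, fun c y => by rw [← hl, Fin.insertNth_apply_succAbove]⟩

lemma IsAngleProfile.admissible {t D L₁ L₂ : ℝ} {Θ : ℝ → ℝ} (h : IsAngleProfile t D Θ)
    {n : Pt → Vec}
    (hn : (fun x => director (Θ (x 2)) (t * x 2)) =ᵐ[volume.restrict (cell L₁ L₂)] n) :
    Admissible L₁ L₂ n := by
  have hN := h.contDiff_director
  have hc : Continuous fun z => director (Θ z) (t * z) :=
    continuous_iff_continuousAt.2 fun z => (h.hasDerivAt_director z).continuousAt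
  have hper : ∀ {i : Fin 3}, i ≠ 2 → ∀ c c' : ℝ, ∃ g : (Fin 2 → ℝ) → Vec,
      HasFaceTrace (lo L₁ L₂) (hi L₁ L₂) n i c g ∧ HasFaceTrace (lo L₁ L₂) (hi L₁ L₂) n i c' g := by
    intro i hi c c'
    obtain ⟨l, hl⟩ := insertNth_apply_two hi
    have hg : Continuous fun y : Fin 2 → ℝ => director (Θ (y l)) (t * y l) :=
      hc.comp (continuous_apply l)
    exact ⟨_, hasFaceTrace_of_contDiff hN hn (fun y => by simp only [hl]) hg,
      hasFaceTrace_of_contDiff hN hn (fun y => by simp only [hl]) hg⟩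
  refine ⟨(memW12_of_contDiff hN).congr hn, ?_, ?_, ?_, hper (by decide) _ _, hper (by decide) _ _⟩
  · filter_upwards [hn] with x hx
    rw [← hx, norm_director]
  · refine hasFaceTrace_of_contDiff hN hn (fun y => ?_) continuous_const
    simp [director, h.map_zero]
  · refine hasFaceTrace_of_contDiff hN hn (fun y => ?_) continuous_const
    simp [director, h.map_one]

/-- The energy exceeds that of the extremal by at least a multiple of the squared `L²` distance. -/
theorem IsAngleProfile.exists_energy_gap {K t D L₁ L₂ : ℝ} {Θ : ℝ → ℝ} (h : IsAngleProfile t D Θ)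
    (hD : t ^ 2 < D) (hK : 0 < K) (hL₁ : 0 < L₁) (hL₂ : 0 < L₂) {nStar : Pt → Vec}
    (hs : (fun x => director (Θ (x 2)) (t * x 2)) =ᵐ[volume.restrict (cell L₁ L₂)] nStar) :
    ∃ μ > 0, ∀ n : Pt → Vec, Admissible L₁ L₂ n → DependsOnlyOnZ L₁ L₂ n →
      energy K t L₁ L₂ nStar + μ * ∫ x in cell L₁ L₂, ‖n x - nStar x‖ ^ 2 ≤
        energy K t L₁ L₂ n := by
  obtain ⟨w, w', μ, hμ, hw, hw'c, hric⟩ := h.exists_riccati hD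
  refine ⟨K * μ, mul_pos hK hμ, fun n hn hz => ?_⟩
  set N : Pt → Vec := fun x => director (Θ (x 2)) (t * x 2) with hNdef
  have hN : ContDiff ℝ 1 N := h.contDiff_director
  have hNd : partialDeriv 2 N = fun x => directorDeriv t D Θ (x 2) :=
    funext fun x => partialDeriv_comp_coord (h.hasDerivAt_director (x 2))
  have hsA : Admissible L₁ L₂ nStar := h.admissible hs
  have hsz : DependsOnlyOnZ L₁ L₂ nStar := ⟨fun z => director (Θ z) (t * z), hs.symm⟩
  obtain ⟨u, hu, hh, hk, h0⟩ := exists_approx_zero_trace hn.memW12 hN hn.bottom hn.top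
    (fun y => by simp [N, director, h.map_zero]) (fun y => by simp [N, director, h.map_one])
  obtain ⟨hli, hlin⟩ := integral_linear_eq_zero hL₁ hL₂ hu hh hk h0 (h.hasDerivAt_momentum hD)
    h.continuous_momentumDeriv
  obtain ⟨hqi, hquad⟩ := integral_quadratic_eq_zero hL₁ hL₂ hu hh hk h0 hw hw'c
  have hfin : IsFiniteMeasure (volume.restrict (cell L₁ L₂)) := isFiniteMeasure_restrict_box _ _
  have hhi := (integrable_inner_of_memLp hh.memLp_lim hh.memLp_lim).const_mul μ
  have hEn := integrable_density (t := t) hn.memW12.1 (hn.memW12.weakPartial_spec 2).1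
  have hEs := integrable_density (t := t) hsA.memW12.1 (hsA.memW12.weakPartial_spec 2).1
  have hmono := integral_mono_ae ((hhi.add hli).sub hqi) (hEn.sub hEs) (by
    filter_upwards [hn.unit, hs, weakPartial_ae_eq_partialDeriv hN hs 2,
      ae_restrict_mem (isOpen_box (lo L₁ L₂) (hi L₁ L₂)).measurableSet] with x hx hsx hpx hxc
    have hxz : x 2 ∈ Icc (0 : ℝ) 1 :=
      ⟨(box_subset_Icc _ _ hxc).1 2, (box_subset_Icc _ _ hxc).2 2⟩
    have key := density_sub_density_ge (g := weakPartial (cell L₁ L₂) 2 n x) hx (hric _ hxz)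
    have hpx' : weakPartial (cell L₁ L₂) 2 nStar x = directorDeriv t D Θ (x 2) := by
      rw [hNd] at hpx
      exact hpx
    simp only [Pi.add_apply, Pi.sub_apply, ← hsx, hpx', hNd]
    exact key)
  have hdist : ∫ x in cell L₁ L₂, ‖n x - nStar x‖ ^ 2 =
      ∫ x in cell L₁ L₂, inner ℝ ((n - N) x) ((n - N) x) := by
    refine integral_congr_ae ?_
    filter_upwards [hs] with x hx
    simp only [Pi.sub_apply, ← hx, real_inner_self_eq_norm_sq]
  rw [integral_sub' (hhi.add hli) hqi, integral_add' hhi hli, hlin, hquad, integral_sub' hEn hEs,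
    integral_const_mul, ← hdist] at hmono
  rw [energy_eq_integral_density hn.memW12 hz, energy_eq_integral_density hsA.memW12 hsz]
  nlinarith [mul_le_mul_of_nonneg_left hmono hK.le]

end Cholesteric

theorem corollary2 (K t L₁ L₂ : ℝ) (hK : 0 < K) (ht : 0 ≤ t) (hL₁ : 0 < L₁) (hL₂ : 0 < L₂) :
    (∃! D : ℝ, Cholesteric.IsTwistConstant t D) ∧
    ∀ D : ℝ, Cholesteric.IsTwistConstant t D →
      t ^ 2 < D ∧
      (∀ z ∈ Icc (0 : ℝ) 1, ∃! s : ℝ, ∫ u in (0 : ℝ)..s, Cholesteric.integrand t D u = z) ∧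
      ∀ θ : ℝ → ℝ,
        (∀ z ∈ Icc (0 : ℝ) 1, ∫ u in (0 : ℝ)..(θ z), Cholesteric.integrand t D u = z) →
        ∀ nStar : Cholesteric.Pt → Cholesteric.Vec,
          (nStar = fun x => Cholesteric.director (θ (x 2)) (t * x 2)) →
          Cholesteric.Admissible L₁ L₂ nStar ∧ Cholesteric.DependsOnlyOnZ L₁ L₂ nStar ∧
          ∀ n : Cholesteric.Pt → Cholesteric.Vec,
            Cholesteric.Admissible L₁ L₂ n → Cholesteric.DependsOnlyOnZ L₁ L₂ n →
            Cholesteric.energy K t L₁ L₂ nStar ≤ Cholesteric.energy K t L₁ L₂ n ∧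
            (Cholesteric.energy K t L₁ L₂ n = Cholesteric.energy K t L₁ L₂ nStar →
              n =ᵐ[volume.restrict (Cholesteric.cell L₁ L₂)] nStar) := by
  open Cholesteric in
  refine ⟨existsUnique_isTwistConstant ht, fun D hDt => ?_⟩
  have hD := hDt.lt ht
  obtain ⟨Θ, hΘ, hiff⟩ := exists_isAngleProfile hD hDt.2.2
  refine ⟨hD, fun z _ => ⟨Θ z, (hiff _ _).2 rfl, fun s hs => (hiff _ _).1 hs⟩,
    fun θ hθ nStar hnStar => ?_⟩
  -- `θ` is arbitrary outside `[0, 1]`, so the two fields agree only on the cell.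
  have hs : (fun x => director (Θ (x 2)) (t * x 2)) =ᵐ[volume.restrict (cell L₁ L₂)] nStar := by
    filter_upwards [ae_restrict_mem (isOpen_box (lo L₁ L₂) (hi L₁ L₂)).measurableSet] with x hx
    have hxz : x 2 ∈ Icc (0 : ℝ) 1 := ⟨(box_subset_Icc _ _ hx).1 2, (box_subset_Icc _ _ hx).2 2⟩
    simp only [hnStar, (hiff _ _).1 (hθ (x 2) hxz)]
  have hA : Admissible L₁ L₂ nStar := hΘ.admissible hs
  refine ⟨hA, ⟨fun z => director (Θ z) (t * z), hs.symm⟩, fun n hn hz => ?_⟩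
  obtain ⟨μ, hμ, hgap⟩ := hΘ.exists_energy_gap hD hK hL₁ hL₂ hs
  have hge := hgap n hn hz
  have hnonneg : 0 ≤ ∫ x in cell L₁ L₂, ‖n x - nStar x‖ ^ 2 :=
    integral_nonneg fun x => by positivity
  refine ⟨by nlinarith [mul_nonneg hμ.le hnonneg], fun heq => ?_⟩
  have hzero : ∫ x in cell L₁ L₂, ‖n x - nStar x‖ ^ 2 = 0 := by
    refine le_antisymm ?_ hnonneg
    have : μ * ∫ x in cell L₁ L₂, ‖n x - nStar x‖ ^ 2 ≤ 0 := by linarith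
    exact nonpos_of_mul_nonpos_right this hμ
  have hint : Integrable (fun x => ‖n x - nStar x‖ ^ 2) (volume.restrict (cell L₁ L₂)) :=
    have := isFiniteMeasure_restrict_box (lo L₁ L₂) (hi L₁ L₂)
    (hn.memW12.1.sub hA.memW12.1).integrable_norm_pow two_ne_zero
  rw [integral_eq_zero_iff_of_nonneg (fun x => by positivity) hint] at hzero
  filter_upwards [hzero] with x hx
  simpa [sub_eq_zero] using hx
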